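/- Let $\kappa$ be an (infinite) regular cardinal. A $(\kappa,\kappa^+)$-cardinal is a family $\mu$ of subsets of $\kappa^+$, each of cardinality less than $\kappa$, satisfying the conditions below. Here $\mu|X=\{Y\in\mu: Y\subsetneq X\}$; $\mathrm{rank}$ is the rank in $(\mu,\subsetneq)$; $A<B$ means that $\alpha<\beta$ for all $\alpha\in A$, $\beta\in B$; $f_{YX}$ is the order isomorphism from $X$ onto $Y$, for sets of ordinals $X,Y$ of the same order type; and $X=X_1*X_2$ means that $X=X_1\cup X_2$, that $X_1,X_2$ have the same order type, and that $X_1\cap X_2<X_1\setminus X_2<X_2\setminus X_1$. 1. $(\mu,\subsetneq)$ is well-founded. 2. $|\mu|X|<\kappa$ for every $X\in\mu$. 3. If $X,Y\in\mu$ have the same rank, then they have the same order type and $\mu|Y=\{f_{YX}[Z]:Z\in\mu|X\}$. 4. For all $X,Y\in\mu$ there is $Z\in\mu$ with $X\cup Y\subseteq Z$. 5. For every $X\in\mu$, either $\mu|X$ is directed under inclusion (the empty family counts as directed), or there are $X_1,X_2\in\mu$ of the same rank with $X=X_1*X_2$ and $\mu|X=(\mu|X_1)\cup(\mu|X_2)\cup\{X_1,X_2\}$.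 6. $\bigcup\mu=\kappa^+$. 7. $X=\bigcup(\mu|X)$ for every $X\in\mu$ of nonzero rank. A Boolean algebra $B$ is superatomic if all its homomorphic images are atomic. Its Cantor–Bendixson ideals are $I_0=\{0\}$, $I_{\alpha+1}$ = the ideal generated by $I_\alpha$ together with all $b\in B$ whose class is an atom of $B/I_\alpha$, and $I_\lambda=\bigcup_{\alpha<\lambda}I_\alpha$ for limit $\lambda$. The height of a superatomic $B$ is the least ordinal $\alpha$ such that $B/I_\alpha$ is finite, and its width is the supremum, over all $\alpha$ below the height, of the number of atoms of $B/I_\alpha$. **Theorem.** If $\kappa$ is a regular cardinal and there exists a $(\kappa,\kappa^+)$-cardinal, then there is a $\kappa$-thin tall superatomic Boolean algebra, that is, a superatomic Boolean algebra of height $\kappa^+$ and width $\kappa$. -/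

import Mathlib

open Cardinal Order

universe u

/-! ### Families of small subsets of the successor cardinal -/

/-- The underlying set of the ordinal `κ⁺`, with its well-order. -/
abbrev SuccCard (κ : Cardinal.{u}) : Type u := (succ κ).ord.ToType

namespace TwoCardinal

/-- `A < B` for sets of ordinals: every element of `A` is below every element of `B`. -/
def SetLT {α : Type u} [LinearOrder α] (A B : Set α) : Prop :=
  ∀ a ∈ A, ∀ b ∈ B, a < b

/-- `X = X₁ * X₂`: the sets `X₁`, `X₂` have the same order type,
`X₁ ∩ X₂ < X₁ \ X₂ < X₂ \ X₁`, and `X` is their union. -/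
def IsStar {α : Type u} [LinearOrder α] (X X₁ X₂ : Set α) : Prop :=
  Nonempty (X₁ ≃o X₂) ∧ SetLT (X₁ ∩ X₂) (X₁ \ X₂) ∧ SetLT (X₁ \ X₂) (X₂ \ X₁) ∧ X = X₁ ∪ X₂

/-- `μ | X`, the members of `μ` that are strictly included in `X`. -/
def below {α : Type u} (μ : Set (Set α)) (X : Set α) : Set (Set α) :=
  {Y | Y ∈ μ ∧ Y ⊂ X}

/-- The rank of a member of `μ` in the well-founded relation of strict inclusion on `μ`. -/
noncomputable def rank {α : Type u} (μ : Set (Set α)) [WellFoundedLT μ] (X : μ) : Ordinal.{u} :=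
  IsWellFounded.rank (fun Y Z : μ => Y < Z) X

/-- The image `f[Z]` of `Z ∩ X` under a map `f` defined on `X` with values in `Y`. -/
def imageOn {α : Type u} {X Y : Set α} (f : X → Y) (Z : Set α) : Set α :=
  {y | ∃ x : X, (x : α) ∈ Z ∧ (f x : α) = y}

end TwoCardinal

open TwoCardinal in
/-- `μ` is a `(κ, κ⁺)`-cardinal (a neat simplified `(κ, 1)`-morass, as a family of sets). -/
structure IsTwoCardinal (κ : Cardinal.{u}) (μ : Set (Set (SuccCard κ))) : Prop where
  /-- `μ ⊆ ℘_κ(κ⁺)` -/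
  card_lt : ∀ X ∈ μ, #X < κ
  [wellFounded : WellFoundedLT μ]
  locally_small : ∀ X ∈ μ, #(below μ X) < κ
  /-- Homogeneity; the order isomorphism `f` from `X` onto `Y` is unique. -/
  homogeneous : ∀ X Y : μ, rank μ X = rank μ Y →
    ∃ f : (X : Set (SuccCard κ)) ≃o (Y : Set (SuccCard κ)),
      below μ Y = {W | ∃ Z ∈ below μ X, W = imageOn f Z}
  directed : ∀ X ∈ μ, ∀ Y ∈ μ, ∃ Z ∈ μ, X ⊆ Z ∧ Y ⊆ Z
  /-- Local almost directedness; the empty family counts as directed. -/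
  locally_almost_directed : ∀ X ∈ μ,
    (∀ Y ∈ below μ X, ∀ Z ∈ below μ X, ∃ W ∈ below μ X, Y ⊆ W ∧ Z ⊆ W) ∨
    ∃ X₁ X₂ : μ, rank μ X₁ = rank μ X₂ ∧ IsStar X X₁ X₂ ∧
      below μ X = below μ X₁ ∪ below μ X₂ ∪ {(X₁ : Set (SuccCard κ)), (X₂ : Set (SuccCard κ))}
  covers : ⋃₀ μ = Set.univ
  neat : ∀ X : μ, rank μ X ≠ 0 → (X : Set (SuccCard κ)) = ⋃₀ below μ X

/-! ### Superatomic Boolean algebras -/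

/-- A quotient of a Boolean ring is a Boolean ring. -/
instance booleanRingQuotient {R : Type u} [BooleanRing R] (I : Ideal R) : BooleanRing (R ⧸ I) where
  isIdempotentElem := by
    intro a
    obtain ⟨r, rfl⟩ := Ideal.Quotient.mk_surjective a
    exact (BooleanRing.isIdempotentElem r).map (Ideal.Quotient.mk I)

/-- The quotient of a Boolean algebra by an ideal, as a Boolean algebra. Ideals of a Boolean
algebra are the ideals of the associated Boolean ring. -/
abbrev BoolQuotient (B : Type u) [BooleanAlgebra B] (I : Ideal (AsBoolRing B)) : Type u :=
  AsBoolAlg (AsBoolRing B ⧸ I)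

/-- The class of `b` in the quotient Boolean algebra. -/
def BoolQuotient.mk {B : Type u} [BooleanAlgebra B] (I : Ideal (AsBoolRing B)) (b : B) :
    BoolQuotient B I :=
  toBoolAlg (Ideal.Quotient.mk I (toBoolRing b))

/-- A Boolean algebra is superatomic if all its homomorphic images are atomic. -/
def IsSuperatomic (B : Type u) [BooleanAlgebra B] : Prop :=
  ∀ (C : Type u) [BooleanAlgebra C] (f : BoundedLatticeHom B C),
    Function.Surjective f → IsAtomic C

/-- The Cantor–Bendixson ideals `I_α` of a Boolean algebra: `I_0 = {0}`, `I_{α+1}` is generated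
by `I_α` and the elements whose class is an atom of `B / I_α`, and unions are taken at limits
(the supremum of an increasing chain of ideals is its union). -/
noncomputable def cbIdeal (B : Type u) [BooleanAlgebra B] (α : Ordinal.{u}) :
    Ideal (AsBoolRing B) :=
  Ordinal.limitRecOn α
    ⊥
    (fun _ I => I ⊔ Ideal.span {r | IsAtom (BoolQuotient.mk I (ofBoolRing r))})
    (fun β _ I => ⨆ γ : Set.Iio β, I γ.1 γ.2)

/-- The atoms of the quotient `B / I_α`, i.e. the `α`-th Cantor–Bendixson level. -/
def cbLevel (B : Type u) [BooleanAlgebra B] (α : Ordinal.{u}) :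
    Set (BoolQuotient B (cbIdeal B α)) :=
  {a | IsAtom a}

/-- The height of a superatomic Boolean algebra: the least `α` such that `B / I_α` is finite. -/
noncomputable def cbHeight (B : Type u) [BooleanAlgebra B] : Ordinal.{u} :=
  sInf {α | Finite (BoolQuotient B (cbIdeal B α))}

/-- The width of a superatomic Boolean algebra: the supremum of the cardinalities of the levels
below the height (all of them are at most `#B`). -/
noncomputable def cbWidth (B : Type u) [BooleanAlgebra B] : Cardinal.{u} :=
  ⨆ α : Set.Iio (cbHeight B), #(cbLevel B α.1)

/-- `B` is a `κ`-thin tall superatomic Boolean algebra. -/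
structure IsThinTall (κ : Cardinal.{u}) (B : Type u) [BooleanAlgebra B] : Prop where
  superatomic : IsSuperatomic B
  height_eq : cbHeight B = (succ κ).ord
  width_eq : cbWidth B = κ

/-!
The algebra is the clopen algebra of the one-point compactification of a locally compact scattered
space with levels of size `κ`, one for each element of `κ⁺`. Such a space is given by a partial
order in which the sets `Set.Iic x` are taken as compact open neighbourhoods
(`IsScatteredOrder`). Two properties matter: `Set.Iic x ∩ Set.Iic y` is a finite union of sets
`Set.Iic v`, and for every `x`, every lower level has a point below `x` that avoids any given
finite union of sets `Set.Iic w` with `¬ x ≤ w`. They imply that the Cantor–Bendixson ideals are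
generated by the neighbourhoods of the points of smaller level (`IsScatteredOrder.cbIdeal_eq`), so
that height and width can be read off from the levels (`IsScatteredOrder.isThinTall`).

The order is built along the family `μ`. The points are pairs of an element of `κ⁺` and a name, and
each `Z` in `μ` carries an order on the points present in `Z`, which is respected by the order
isomorphisms between sets of the same rank.
* In `Z = Z₁ * Z₂` the orders of `Z₁` and `Z₂` are amalgamated by putting every point of `Z₁` below
  its copy in `Z₂`. Then the points of `Z₁` below a point of `Z₂` are those below its copy in `Z₁`,
  so that finite generation of common lower bounds passes from `Z₁` to `Z`.
* In a directed `Z` the union of the smaller orders is taken.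
* Afterwards, for each old point `x` of `Z` and each element `a` of `Z` smaller than the level of
  `x`, a new minimal point of level `a` is added, and the other points of `Z` above it are exactly
  `x` and the points of `Z` above `x`. This preserves finite generation, and yields the second
  property of the space. The name of the new point records the rank of `Z`, the position in `Z` of
  the level of `x`, and the name of `x`. Hence there are only `κ` names, and the construction is
  invariant under the isomorphisms.

By induction on `Z`, the order of the points of a set is not changed in larger sets
(`IsTwoCardinal.leIn_restrict`), finite generating sets of common lower bounds persist in larger
sets (`IsTwoCardinal.coversMeet_mono`), and they exist (`IsTwoCardinal.exists_coversMeet`).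
Coherence, that is, that the common elements of two sets of the same rank form an initial segment of
both (`IsTwoCardinal.mem_iff_of_rank_eq`), together with the regularity of `κ` gives sets of
arbitrarily large rank below `κ`, so that every point is present in some set.
-/

/-! ### Quotients of Boolean algebras -/

namespace BoolQuotient

variable {B : Type u} [BooleanAlgebra B] {I : Ideal (AsBoolRing B)}

lemma mk_surjective : Function.Surjective (BoolQuotient.mk I) := by
  intro a
  obtain ⟨r, hr⟩ := Ideal.Quotient.mk_surjective (ofBoolAlg a)
  refine ⟨ofBoolRing r, ?_⟩
  simp [BoolQuotient.mk, hr]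

lemma mk_eq_bot {b : B} : BoolQuotient.mk I b = ⊥ ↔ toBoolRing b ∈ I := by
  rw [← Ideal.Quotient.eq_zero_iff_mem, ← toBoolAlg_zero, BoolQuotient.mk, toBoolAlg_inj]

lemma mk_inf (a b : B) :
    BoolQuotient.mk I (a ⊓ b) = BoolQuotient.mk I a ⊓ BoolQuotient.mk I b := by
  simp [BoolQuotient.mk]

lemma mk_symmDiff (a b : B) :
    BoolQuotient.mk I (symmDiff a b) = symmDiff (BoolQuotient.mk I a) (BoolQuotient.mk I b) := by
  simp [BoolQuotient.mk]

lemma mk_eq_mk {a b : B} :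
    BoolQuotient.mk I a = BoolQuotient.mk I b ↔ toBoolRing (symmDiff a b) ∈ I := by
  rw [← mk_eq_bot, mk_symmDiff, symmDiff_eq_bot]

lemma isAtom_mk {b : B} : IsAtom (BoolQuotient.mk I b) ↔
    toBoolRing b ∉ I ∧ ∀ c ≤ b, toBoolRing c ∈ I ∨ toBoolRing (b \ c) ∈ I := by
  have key : ∀ c ≤ b, (BoolQuotient.mk I c = BoolQuotient.mk I b ↔ toBoolRing (b \ c) ∈ I) := by
    intro c hc
    rw [mk_eq_mk, symmDiff_of_le hc]
  rw [isAtom_iff_le_of_ge, Ne, mk_eq_bot]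
  refine and_congr_right fun hb => ⟨fun h c hc => ?_, fun h d hd hdb => ?_⟩
  · by_cases hcI : toBoolRing c ∈ I
    · exact Or.inl hcI
    · have hle : BoolQuotient.mk I c ≤ BoolQuotient.mk I b := by
        rw [← inf_eq_left, ← mk_inf, inf_eq_left.2 hc]
      exact Or.inr ((key c hc).1 (le_antisymm hle (h _ (mt mk_eq_bot.1 hcI) hle)))
  · obtain ⟨d, rfl⟩ := mk_surjective d
    have hd' : BoolQuotient.mk I (d ⊓ b) = BoolQuotient.mk I d := by
      rw [mk_inf, inf_eq_left.2 hdb]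
    rcases h (d ⊓ b) inf_le_right with h1 | h1
    · exact absurd (hd'.symm.trans (mk_eq_bot.2 h1)) hd
    · rw [← hd', (key _ inf_le_right).2 h1]

end BoolQuotient

/-- A Boolean ring ideal is closed downwards. -/
lemma toBoolRing_mem_of_le {B : Type u} [BooleanAlgebra B] {I : Ideal (AsBoolRing B)} {a b : B}
    (hab : a ≤ b) (hb : toBoolRing b ∈ I) : toBoolRing a ∈ I := by
  rw [← inf_eq_left.2 hab, toBoolRing_inf]
  exact I.mul_mem_left _ hb

lemma toBoolRing_sup_mem {B : Type u} [BooleanAlgebra B] {I : Ideal (AsBoolRing B)} {a b : B}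
    (ha : toBoolRing a ∈ I) (hb : toBoolRing b ∈ I) : toBoolRing (a ⊔ b) ∈ I := by
  have : a ⊔ b = symmDiff a (b \ a) := by
    rw [symmDiff_eq_sup_sdiff_inf, disjoint_sdiff_self_right.eq_bot, sdiff_bot, sup_sdiff_self_right]
  rw [this, toBoolRing_symmDiff]
  exact I.add_mem ha (toBoolRing_mem_of_le sdiff_le hb)

section cbIdeal

variable (B : Type u) [BooleanAlgebra B]

lemma cbIdeal_zero : cbIdeal B 0 = ⊥ := by
  rw [cbIdeal, Ordinal.limitRecOn_zero]

lemma cbIdeal_add_one (α : Ordinal.{u}) : cbIdeal B (α + 1) = cbIdeal B α ⊔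
    Ideal.span {r | IsAtom (BoolQuotient.mk (cbIdeal B α) (ofBoolRing r))} := by
  rw [cbIdeal, Ordinal.limitRecOn_add_one]
  rfl

lemma cbIdeal_limit {α : Ordinal.{u}} (h : IsSuccLimit α) :
    cbIdeal B α = ⨆ γ : Set.Iio α, cbIdeal B γ.1 := by
  rw [cbIdeal, Ordinal.limitRecOn_limit _ _ _ _ h]
  rfl

end cbIdeal

/-! ### The algebra of a scattered order -/

/-- `S` is covered by finitely many principal lower sets with vertices in `P`. -/
def FinCovered {T : Type u} [PartialOrder T] (P S : Set T) : Prop :=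
  ∃ F : Set T, F.Finite ∧ F ⊆ P ∧ ∀ u ∈ S, ∃ v ∈ F, u ≤ v

namespace FinCovered

variable {T : Type u} [PartialOrder T] {P Q S S' : Set T}

lemma mono (h : FinCovered P S) (hPQ : P ⊆ Q) (hS : S' ⊆ S) : FinCovered Q S' := by
  obtain ⟨F, hF, hFP, hc⟩ := h
  exact ⟨F, hF, hFP.trans hPQ, fun u hu => hc u (hS hu)⟩

lemma empty : FinCovered P ∅ := ⟨∅, Set.finite_empty, Set.empty_subset _, by simp⟩

lemma union (h : FinCovered P S) (h' : FinCovered P S') : FinCovered P (S ∪ S') := by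
  obtain ⟨F, hF, hFP, hc⟩ := h
  obtain ⟨G, hG, hGP, hd⟩ := h'
  refine ⟨F ∪ G, hF.union hG, Set.union_subset hFP hGP, ?_⟩
  rintro u (hu | hu)
  · obtain ⟨v, hv, huv⟩ := hc u hu
    exact ⟨v, Or.inl hv, huv⟩
  · obtain ⟨v, hv, huv⟩ := hd u hu
    exact ⟨v, Or.inr hv, huv⟩

lemma Iic {x : T} (hx : x ∈ P) : FinCovered P (Set.Iic x) :=
  ⟨{x}, Set.finite_singleton x, by simpa using hx, fun u hu => ⟨x, rfl, hu⟩⟩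

/-- If `S` is covered by lower sets whose traces on `S` are covered, then `S` is covered. -/
lemma trans {P Q : Set T} (h : FinCovered Q S)
    (hQ : ∀ w ∈ Q, FinCovered P (S ∩ Set.Iic w)) : FinCovered P S := by
  obtain ⟨F, hF, hFQ, hc⟩ := h
  have : ∀ G : Set T, G.Finite → G ⊆ Q → FinCovered P {u ∈ S | ∃ v ∈ G, u ≤ v} := by
    intro G hG
    induction G, hG using Set.Finite.induction_on with
    | empty => intro _; exact empty.mono subset_rfl (by simp)
    | @insert a s _ _ ih =>
      intro hs
      refine ((hQ a (hs (Set.mem_insert _ _))).union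
        (ih ((Set.subset_insert _ _).trans hs))).mono subset_rfl ?_
      rintro u ⟨hu, v, (rfl | hv), huv⟩
      · exact Or.inl ⟨hu, huv⟩
      · exact Or.inr ⟨hu, v, hv, huv⟩
  exact (this F hF hFQ).mono subset_rfl fun u hu => ⟨hu, hc u hu⟩

end FinCovered

/-- A partial order with levels below `θ`, whose sets `Set.Iic x` are the compact open
neighbourhoods of a locally compact scattered topology with Cantor–Bendixson levels the levels of
the order. -/
structure IsScatteredOrder (T : Type u) [PartialOrder T] (lev : T → Ordinal.{u})
    (θ : Ordinal.{u}) : Prop where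
  strictMono : StrictMono lev
  lev_lt : ∀ x, lev x < θ
  isSuccLimit : IsSuccLimit θ
  /-- Every level is nonempty. -/
  surj : ∀ α < θ, ∃ x, lev x = α
  /-- `Set.Iic x ∩ Set.Iic y` is a finite union of sets `Set.Iic v`. -/
  meets : ∀ x y : T, ∃ F : Set T, F.Finite ∧ ∀ u, (u ≤ x ∧ u ≤ y) ↔ ∃ v ∈ F, u ≤ v
  /-- Every point is a limit of points of every lower level. -/
  exists_below : ∀ x, ∀ α < lev x, ∀ F : Set T, F.Finite → (∀ w ∈ F, ¬ x ≤ w) →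
    ∃ z, lev z = α ∧ z ≤ x ∧ ∀ w ∈ F, ¬ z ≤ w

/-- The algebra of those sets `b` such that each point `x` has, up to finitely many `Set.Iic w`
with `w < x`, its neighbourhood `Set.Iic x` inside `b` or inside the complement of `b`, and such
that `b` or its complement is included in a finite union of sets `Set.Iic w`. These are the clopen
sets of the one-point compactification of the scattered space of the order. -/
def clopenAlgebra (T : Type u) [PartialOrder T] : BooleanSubalgebra (Set T) where
  carrier := {b | (FinCovered Set.univ b ∨ FinCovered Set.univ bᶜ) ∧
    ∀ x, (x ∉ b → FinCovered (Set.Iio x) (b ∩ Set.Iic x)) ∧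
      (x ∈ b → FinCovered (Set.Iio x) (bᶜ ∩ Set.Iic x))}
  supClosed' := by
    rintro a ⟨ha, ha'⟩ b ⟨hb, hb'⟩
    refine ⟨?_, fun x => ⟨fun hx => ?_, ?_⟩⟩
    · rcases ha with ha | ha
      · rcases hb with hb | hb
        · exact Or.inl (ha.union hb)
        · exact Or.inr (hb.mono subset_rfl (Set.compl_subset_compl.2 Set.subset_union_right))
      · exact Or.inr (ha.mono subset_rfl (Set.compl_subset_compl.2 Set.subset_union_left))
    · simp only [Set.sup_eq_union, Set.mem_union, not_or] at hx
      refine (((ha' x).1 hx.1).union ((hb' x).1 hx.2)).mono subset_rfl ?_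
      exact (Set.union_inter_distrib_right a b _).subset
    · rintro (hx | hx)
      · refine ((ha' x).2 hx).mono subset_rfl ?_
        exact Set.inter_subset_inter_left _ (Set.compl_subset_compl.2 Set.subset_union_left)
      · refine ((hb' x).2 hx).mono subset_rfl ?_
        exact Set.inter_subset_inter_left _ (Set.compl_subset_compl.2 Set.subset_union_right)
  infClosed' := by
    rintro a ⟨ha, ha'⟩ b ⟨hb, hb'⟩
    refine ⟨?_, fun x => ⟨fun hx => ?_, ?_⟩⟩
    · rcases ha with ha | ha
      · exact Or.inl (ha.mono subset_rfl Set.inter_subset_left)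
      · rcases hb with hb | hb
        · exact Or.inl (hb.mono subset_rfl Set.inter_subset_right)
        · refine Or.inr ((ha.union hb).mono subset_rfl ?_)
          exact (Set.compl_inter a b).subset
    · by_cases hxa : x ∈ a
      · have hxb : x ∉ b := fun h => hx ⟨hxa, h⟩
        exact ((hb' x).1 hxb).mono subset_rfl
          (Set.inter_subset_inter_left _ Set.inter_subset_right)
      · exact ((ha' x).1 hxa).mono subset_rfl
          (Set.inter_subset_inter_left _ Set.inter_subset_left)
    · rintro ⟨hxa, hxb⟩
      refine (((ha' x).2 hxa).union ((hb' x).2 hxb)).mono subset_rfl ?_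
      rw [← Set.union_inter_distrib_right, ← Set.compl_inter]
      rfl
  compl_mem' := by
    rintro a ⟨ha, ha'⟩
    refine ⟨?_, fun x => ⟨fun hx => ?_, fun hx => ?_⟩⟩
    · rw [compl_compl]; exact ha.symm
    · exact (ha' x).2 (by simpa using hx)
    · rw [compl_compl]; exact (ha' x).1 hx
  bot_mem' := by
    refine ⟨Or.inl FinCovered.empty, fun x => ⟨fun _ => ?_, fun h => h.elim⟩⟩
    exact FinCovered.empty.mono subset_rfl (by simp)

namespace IsScatteredOrder

variable {T : Type u} [PartialOrder T] {lev : T → Ordinal.{u}} {θ : Ordinal.{u}}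

lemma Iic_mem (h : IsScatteredOrder T lev θ) (y : T) : Set.Iic y ∈ clopenAlgebra T := by
  refine ⟨Or.inl (FinCovered.Iic trivial), fun x => ⟨fun hx => ?_, fun hx => ?_⟩⟩
  · obtain ⟨F, hF, hc⟩ := h.meets x y
    refine ⟨F, hF, fun v hv => ?_, fun u hu => (hc u).1 ⟨hu.2, hu.1⟩⟩
    have hv' := (hc v).2 ⟨v, hv, le_rfl⟩
    exact lt_of_le_of_ne hv'.1 (by rintro rfl; exact hx hv'.2)
  · refine FinCovered.empty.mono subset_rfl ?_
    rintro u ⟨hu, hux⟩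
    exact hu (le_trans hux hx)

/-- The set `Set.Iic x` as an element of the algebra. -/
def nhd (h : IsScatteredOrder T lev θ) (x : T) : clopenAlgebra T := ⟨Set.Iic x, h.Iic_mem x⟩

lemma wellFounded (h : IsScatteredOrder T lev θ) : WellFoundedLT T :=
  ⟨(InvImage.wf lev Ordinal.lt_wf).mono fun _ _ hab => h.strictMono hab⟩

/-- The ideal of those sets of the algebra that are included in a finite union of sets `Set.Iic w`
with `lev w < α`. -/
def levelIdeal (T : Type u) [PartialOrder T] (lev : T → Ordinal.{u}) (α : Ordinal.{u}) :
    Ideal (AsBoolRing (clopenAlgebra T)) where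
  carrier := {r | FinCovered {x | lev x < α} ((ofBoolRing r : clopenAlgebra T) : Set T)}
  zero_mem' := by
    change FinCovered _ ((⊥ : clopenAlgebra T) : Set T)
    exact FinCovered.empty
  add_mem' := by
    intro a b ha hb
    refine (FinCovered.union ha hb).mono subset_rfl ?_
    rw [ofBoolRing_add]
    rintro x (hx | hx)
    · exact Or.inl hx.1
    · exact Or.inr hx.1
  smul_mem' := by
    intro c a ha
    exact FinCovered.mono ha subset_rfl (fun x hx => hx.2)

lemma mem_levelIdeal {α : Ordinal.{u}} {b : clopenAlgebra T} :
    toBoolRing b ∈ levelIdeal T lev α ↔ FinCovered {x | lev x < α} (b : Set T) := Iff.rfl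

/-- A compact open set all of whose points have level below `α` lies in the ideal. -/
lemma finCovered_of_lev_lt (h : IsScatteredOrder T lev θ) {α : Ordinal.{u}} {b : Set T}
    (hb : b ∈ clopenAlgebra T) (hcov : FinCovered Set.univ b) (hlev : ∀ x ∈ b, lev x < α) :
    FinCovered {x | lev x < α} b := by
  have := h.wellFounded
  refine hcov.trans fun x _ => ?_
  induction x using WellFoundedLT.induction with
  | ind x ih =>
    by_cases hx : x ∈ b
    · exact (FinCovered.Iic (P := {x | lev x < α}) (x := x) (hlev x hx)).mono subset_rfl
        Set.inter_subset_right
    · refine ((hb.2 x).1 hx).trans fun w hw => ?_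
      refine (ih w hw trivial).mono subset_rfl ?_
      exact Set.inter_subset_inter_left _ Set.inter_subset_left

lemma lev_lt_of_finCovered (h : IsScatteredOrder T lev θ) {α : Ordinal.{u}} {b : Set T}
    (hb : FinCovered {x | lev x < α} b) {x : T} (hx : x ∈ b) : lev x < α := by
  obtain ⟨F, -, hF, hc⟩ := hb
  obtain ⟨v, hv, hxv⟩ := hc x hx
  exact (h.strictMono.monotone hxv).trans_lt (hF hv)

/-- A set of the algebra outside the ideal of level `α < θ` has a point of level at least `α`. -/
lemma exists_le_lev (h : IsScatteredOrder T lev θ) {α : Ordinal.{u}} (hα : α < θ)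
    {b : clopenAlgebra T} (hb : toBoolRing b ∉ levelIdeal T lev α) :
    ∃ x ∈ (b : Set T), α ≤ lev x := by
  by_contra! hlt
  rcases b.2.1 with hc | hc
  · exact hb (h.finCovered_of_lev_lt b.2 hc hlt)
  -- otherwise every point of level at least `α` lies in a finite union of lower sets
  · obtain ⟨F, hF, -, hc⟩ := hc
    obtain ⟨β, hβ, hβF⟩ : ∃ β < θ, ∀ v ∈ F, lev v < β := by
      clear hc
      induction F, hF using Set.Finite.induction_on with
      | empty => exact ⟨α, hα, by simp⟩
      | @insert a s _ _ ih =>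
        obtain ⟨β, hβ, hs⟩ := ih
        refine ⟨max β (succ (lev a)), max_lt hβ (h.isSuccLimit.succ_lt (h.lev_lt a)), ?_⟩
        rintro v (rfl | hv)
        · exact lt_max_of_lt_right (lt_succ _)
        · exact lt_max_of_lt_left (hs v hv)
    obtain ⟨x, hx⟩ := h.surj (max α β) (max_lt hα hβ)
    obtain ⟨v, hv, hxv⟩ := hc x fun hxb => (hlt x hxb).not_ge (hx ▸ le_max_left _ _)
    have := (h.strictMono.monotone hxv).trans_lt (hβF v hv)
    exact (hx ▸ this).not_ge (le_max_right _ _)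

/-- The class of the neighbourhood of a point of level `α` is an atom modulo level `α`. -/
lemma isAtom_nhd (h : IsScatteredOrder T lev θ) (x : T) :
    IsAtom (BoolQuotient.mk (levelIdeal T lev (lev x)) (h.nhd x)) := by
  refine BoolQuotient.isAtom_mk.2 ⟨fun hx => ?_, fun c hc => ?_⟩
  · exact lt_irrefl _ (h.lev_lt_of_finCovered (mem_levelIdeal.1 hx) (Set.mem_Iic.2 le_rfl))
  · have hsub : Set.Iio x ⊆ {w | lev w < lev x} := fun w hw => h.strictMono hw
    by_cases hxc : x ∈ (c : Set T)
    · refine Or.inr (((c.2.2 x).2 hxc).mono hsub ?_)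
      exact fun u hu => ⟨hu.2, hu.1⟩
    · exact Or.inl (((c.2.2 x).1 hxc).mono hsub fun u hu => ⟨hu, hc hu⟩)

/-- If the class of `b` is an atom modulo level `α`, then all points of `b` have level at
most `α`: a point of higher level would bring in two points of level `α`. -/
lemma lev_le_of_isAtom (h : IsScatteredOrder T lev θ) {α : Ordinal.{u}} {b : clopenAlgebra T}
    (hb : IsAtom (BoolQuotient.mk (levelIdeal T lev α) b)) {x : T} (hx : x ∈ (b : Set T)) :
    lev x ≤ α := by
  by_contra! hlt
  obtain ⟨F, hF, hFx, hc⟩ := (b.2.2 x).2 hx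
  obtain ⟨z, hz, hzx, hzF⟩ := h.exists_below x α hlt F hF fun w hw => (hFx hw).not_ge
  obtain ⟨y, hy, hyx, hyF⟩ := h.exists_below x α hlt (insert z F) (hF.insert z) (by
    rintro w (rfl | hw)
    · intro hxz
      exact (h.strictMono.monotone hxz).not_gt (hz ▸ hlt)
    · exact (hFx hw).not_ge)
  have hmem : ∀ w, w ≤ x → (∀ v ∈ F, ¬ w ≤ v) → w ∈ (b : Set T) := by
    intro w hw hwF
    by_contra hwb
    obtain ⟨v, hv, hwv⟩ := hc w ⟨hwb, hw⟩
    exact hwF v hv hwv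
  rcases (BoolQuotient.isAtom_mk.1 hb).2 (b ⊓ h.nhd z) inf_le_left with h1 | h1
  · exact (h.lev_lt_of_finCovered (mem_levelIdeal.1 h1)
      (x := z) ⟨hmem z hzx hzF, Set.mem_Iic.2 le_rfl⟩).ne hz
  · refine (h.lev_lt_of_finCovered (mem_levelIdeal.1 h1) (x := y) ⟨hmem y hyx fun v hv =>
      hyF v (Or.inr hv), fun hyz => hyF z (Or.inl rfl) hyz.2⟩).ne hy

/-- A finite union of neighbourhoods belonging to an ideal belongs to it. -/
lemma mem_of_finCovered (h : IsScatteredOrder T lev θ) {I : Ideal (AsBoolRing (clopenAlgebra T))}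
    {P : Set T} (hP : ∀ x ∈ P, toBoolRing (h.nhd x) ∈ I) {b : clopenAlgebra T}
    (hb : FinCovered P (b : Set T)) : toBoolRing b ∈ I := by
  obtain ⟨F, hF, hFP, hc⟩ := hb
  obtain ⟨c, hcI, hc'⟩ : ∃ c : clopenAlgebra T, toBoolRing c ∈ I ∧ ∀ v ∈ F, h.nhd v ≤ c := by
    clear hc
    induction F, hF using Set.Finite.induction_on with
    | empty => exact ⟨⊥, by rw [toBoolRing_bot]; exact I.zero_mem, by simp⟩
    | @insert a s _ _ ih =>
      obtain ⟨c, hcI, hc⟩ := ih ((Set.subset_insert _ _).trans hFP)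
      refine ⟨h.nhd a ⊔ c, toBoolRing_sup_mem (hP a (hFP (Set.mem_insert _ _))) hcI, ?_⟩
      rintro v (rfl | hv)
      · exact le_sup_left
      · exact (hc v hv).trans le_sup_right
  refine toBoolRing_mem_of_le (b := c) (fun u hu => ?_) hcI
  obtain ⟨v, hv, huv⟩ := hc u hu
  exact hc' v hv huv

/-- The Cantor–Bendixson ideals are the ideals of the levels. -/
theorem cbIdeal_eq (h : IsScatteredOrder T lev θ) {α : Ordinal.{u}} (hα : α ≤ θ) :
    cbIdeal (clopenAlgebra T) α = levelIdeal T lev α := by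
  induction α using Ordinal.limitRecOn with
  | zero =>
    rw [cbIdeal_zero]
    refine le_antisymm bot_le fun r hr => ?_
    obtain ⟨F, -, hF, hc⟩ := hr
    have : ofBoolRing r = ⊥ := by
      refine Subtype.ext (Set.eq_empty_of_forall_notMem fun u hu => ?_)
      obtain ⟨v, hv, -⟩ := hc u hu
      exact not_lt_zero (show lev v < 0 from hF hv)
    exact this
  | add_one α ih =>
    have hα' : α < θ := (Order.lt_succ α).trans_le hα
    rw [cbIdeal_add_one, ih hα'.le]
    apply le_antisymm
    · refine sup_le (fun r hr => FinCovered.mono hr (fun x hx => ?_) subset_rfl) ?_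
      · exact (show lev x < α from hx).trans (Order.lt_succ α)
      · refine Ideal.span_le.2 fun r hr => ?_
        have hr1 : ∀ x ∈ ((ofBoolRing r : clopenAlgebra T) : Set T), lev x < α + 1 :=
          fun x hx => Order.lt_succ_iff.2 (h.lev_le_of_isAtom hr hx)
        by_contra hrm
        obtain ⟨x, hx, hαx⟩ := h.exists_le_lev (h.isSuccLimit.succ_lt hα') hrm
        exact (hr1 x hx).not_ge hαx
    · intro r hr
      refine h.mem_of_finCovered (b := ofBoolRing r) (fun x hx => ?_) hr
      rcases (Order.lt_succ_iff.1 hx : lev x ≤ α).lt_or_eq with hlt | rfl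
      · exact Ideal.mem_sup_left (mem_levelIdeal.2 (FinCovered.Iic hlt))
      · exact Ideal.mem_sup_right (Ideal.subset_span (h.isAtom_nhd x))
  | limit α hlim ih =>
    rw [cbIdeal_limit _ hlim]
    apply le_antisymm
    · refine iSup_le fun γ => ?_
      rw [ih γ.1 γ.2 (γ.2.le.trans hα)]
      exact fun r hr => FinCovered.mono hr
        (fun x hx => (show lev x < γ.1 from hx).trans γ.2) subset_rfl
    · intro r hr
      refine h.mem_of_finCovered (b := ofBoolRing r) (fun x hx => ?_) hr
      have hlt : succ (lev x) < α := hlim.succ_lt hx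
      refine Ideal.mem_iSup_of_mem (⟨succ (lev x), hlt⟩ : Set.Iio α) ?_
      rw [ih _ hlt (hlt.le.trans hα)]
      exact mem_levelIdeal.2 (FinCovered.Iic (Order.lt_succ (lev x)))

/-- The atoms of the quotient by the ideal of level `α` correspond to the points of level `α`. -/
theorem mk_atoms (h : IsScatteredOrder T lev θ) {α : Ordinal.{u}} (hα : α < θ) :
    #{a : BoolQuotient (clopenAlgebra T) (levelIdeal T lev α) | IsAtom a} =
      #{x | lev x = α} := by
  symm
  refine Cardinal.mk_congr (Equiv.ofBijective
    (fun x => ⟨BoolQuotient.mk _ (h.nhd x.1), by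
      have := h.isAtom_nhd x.1
      rwa [show lev x.1 = α from x.2] at this⟩) ⟨?_, ?_⟩)
  · have key : ∀ x y : {x | lev x = α}, BoolQuotient.mk (levelIdeal T lev α) (h.nhd x.1) =
        BoolQuotient.mk (levelIdeal T lev α) (h.nhd y.1) → x.1 ≤ y.1 := by
      intro x y hxy
      by_contra hn
      exact (h.lev_lt_of_finCovered (mem_levelIdeal.1 (BoolQuotient.mk_eq_mk.1 hxy))
        (x := x.1) (Or.inl ⟨Set.mem_Iic.2 le_rfl, hn⟩)).ne x.2
    intro x y hxy
    have hxy' := congrArg Subtype.val hxy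
    exact Subtype.ext (le_antisymm (key x y hxy') (key y x hxy'.symm))
  · rintro ⟨a, ha⟩
    obtain ⟨b, rfl⟩ := BoolQuotient.mk_surjective a
    obtain ⟨x, hx, hαx⟩ := h.exists_le_lev hα (BoolQuotient.isAtom_mk.1 ha).1
    have hxα : lev x = α := le_antisymm (h.lev_le_of_isAtom ha hx) hαx
    refine ⟨⟨x, hxα⟩, Subtype.ext ?_⟩
    have hat : IsAtom (BoolQuotient.mk (levelIdeal T lev α) (h.nhd x)) := hxα ▸ h.isAtom_nhd x
    by_contra hne
    have hbot := (hat.disjoint_of_ne ha hne).eq_bot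
    rw [← BoolQuotient.mk_inf, BoolQuotient.mk_eq_bot] at hbot
    exact (h.lev_lt_of_finCovered (mem_levelIdeal.1 hbot)
      (x := x) ⟨Set.mem_Iic.2 le_rfl, hx⟩).ne hxα

theorem isSuperatomic (h : IsScatteredOrder T lev θ) : IsSuperatomic (clopenAlgebra T) := by
  intro C _ f hf
  have := h.wellFounded
  -- `f` vanishes on what is covered by sets on which it vanishes
  have hcov : ∀ (P : Set T) (b c : clopenAlgebra T), (∀ w ∈ P, f (h.nhd w ⊓ b) = ⊥) →
      c ≤ b → FinCovered P (c : Set T) → f c = ⊥ := by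
    rintro P b c hP hcb ⟨F, hF, hFP, hc⟩
    obtain ⟨d, hd, hd'⟩ : ∃ d : clopenAlgebra T, f (d ⊓ b) = ⊥ ∧ ∀ v ∈ F, h.nhd v ≤ d := by
      clear hc
      induction F, hF using Set.Finite.induction_on with
      | empty => exact ⟨⊥, by simp, by simp⟩
      | @insert a s _ _ ih =>
        obtain ⟨c, hcI, hc⟩ := ih ((Set.subset_insert _ _).trans hFP)
        refine ⟨h.nhd a ⊔ c, ?_, ?_⟩
        · rw [inf_sup_right, map_sup, hcI, hP a (hFP (Set.mem_insert _ _)), sup_bot_eq]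
        rintro v (rfl | hv)
        · exact le_sup_left
        · exact (hc v hv).trans le_sup_right
    have hle : c ≤ d ⊓ b := by
      refine le_inf (fun u hu => ?_) hcb
      obtain ⟨v, hv, huv⟩ := hc u hu
      exact hd' v hv huv
    exact le_bot_iff.1 (hd ▸ OrderHomClass.mono f hle)
  -- an element that `f` cannot split into two nonzero parts gives an atom
  have hatom : ∀ b : clopenAlgebra T, f b ≠ ⊥ → (∀ c ≤ b, f c = ⊥ ∨ f (b \ c) = ⊥) →
      IsAtom (f b) := by
    intro b hb hs
    rw [isAtom_iff_le_of_ge]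
    refine ⟨hb, fun d hd hdb => ?_⟩
    obtain ⟨d, rfl⟩ := hf d
    have hd' : f (d ⊓ b) = f d := by rw [map_inf, inf_eq_left.2 hdb]
    rcases hs (d ⊓ b) inf_le_right with h1 | h1
    · exact absurd (hd'.symm.trans h1) hd
    · have : b = (d ⊓ b) ⊔ (b \ (d ⊓ b)) := by
        rw [sup_sdiff_self_right, sup_eq_right.2 inf_le_right]
      rw [this, map_sup, h1, hd', sup_bot_eq]
  refine ⟨fun c => ?_⟩
  obtain ⟨b, rfl⟩ := hf c
  by_cases hb : f b = ⊥
  · exact Or.inl hb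
  right
  by_cases hex : ∃ x, f (h.nhd x ⊓ b) ≠ ⊥
  · obtain ⟨x, hx, hmin⟩ := WellFounded.has_min (wellFounded_lt (α := T))
      {x | f (h.nhd x ⊓ b) ≠ ⊥} hex
    have hP : ∀ w ∈ Set.Iio x, f (h.nhd w ⊓ b) = ⊥ := fun w hw => by
      by_contra hne
      exact hmin w hne hw
    refine ⟨f (h.nhd x ⊓ b), hatom _ hx fun c hc => ?_, OrderHomClass.mono f inf_le_right⟩
    by_cases hxc : x ∈ (c : Set T)
    · refine Or.inr (hcov _ b _ hP (sdiff_le.trans inf_le_right) ?_)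
      exact ((c.2.2 x).2 hxc).mono subset_rfl fun u hu => ⟨hu.2, hu.1.1⟩
    · refine Or.inl (hcov _ b _ hP (hc.trans inf_le_right) ?_)
      exact ((c.2.2 x).1 hxc).mono subset_rfl fun u hu => ⟨hu, (hc hu).1⟩
  · push Not at hex
    refine ⟨f b, hatom b hb fun c hc => ?_, le_rfl⟩
    rcases c.2.1 with h1 | h1
    · exact Or.inl (hcov _ b c (fun w _ => hex w) hc h1)
    · exact Or.inr (hcov _ b _ (fun w _ => hex w) sdiff_le (h1.mono subset_rfl fun u hu => hu.2))

theorem cbHeight_eq (h : IsScatteredOrder T lev θ)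
    (hinf : ∀ α < θ, ℵ₀ ≤ #{x | lev x = α}) : cbHeight (clopenAlgebra T) = θ := by
  have hfin : Finite (BoolQuotient (clopenAlgebra T) (cbIdeal (clopenAlgebra T) θ)) := by
    rw [h.cbIdeal_eq le_rfl]
    -- a set of the algebra or its complement is covered, hence is zero in the quotient
    refine Set.finite_univ_iff.1 ((Set.toFinite
      {BoolQuotient.mk (levelIdeal T lev θ) ⊥, BoolQuotient.mk (levelIdeal T lev θ) ⊤}).subset ?_)
    rintro a -
    obtain ⟨b, rfl⟩ := BoolQuotient.mk_surjective a
    have huniv : (Set.univ : Set T) ⊆ {x | lev x < θ} := fun x _ => h.lev_lt x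
    rcases b.2.1 with hb | hb
    · left
      rw [BoolQuotient.mk_eq_mk, symmDiff_bot]
      exact hb.mono huniv subset_rfl
    · right
      rw [Set.mem_singleton_iff, BoolQuotient.mk_eq_mk, symmDiff_top]
      exact hb.mono huniv subset_rfl
  refine le_antisymm (csInf_le' hfin) (le_csInf ⟨θ, hfin⟩ fun α hα => ?_)
  by_contra! hlt
  have hfinα : Finite (BoolQuotient (clopenAlgebra T) (cbIdeal (clopenAlgebra T) α)) := hα
  rw [h.cbIdeal_eq hlt.le] at hfinα
  have h1 := hinf α hlt
  rw [← h.mk_atoms hlt] at h1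
  exact h1.not_gt (Cardinal.lt_aleph0_of_finite _)

/-- The algebra of a scattered order of height `κ⁺` all of whose levels have size `κ` is thin
tall. -/
theorem isThinTall {κ : Cardinal.{u}} (hκ : ℵ₀ ≤ κ) (h : IsScatteredOrder T lev (succ κ).ord)
    (hlev : ∀ α < (succ κ).ord, #{x | lev x = α} = κ) : IsThinTall κ (clopenAlgebra T) where
  superatomic := h.isSuperatomic
  height_eq := h.cbHeight_eq fun α hα => hκ.trans (hlev α hα).ge
  width_eq := by
    have hh := h.cbHeight_eq fun α hα => hκ.trans (hlev α hα).ge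
    have hpos : 0 < (succ κ).ord := h.isSuccLimit.bot_lt
    have : Nonempty (Set.Iio (cbHeight (clopenAlgebra T))) := ⟨⟨0, by rw [hh]; exact hpos⟩⟩
    rw [cbWidth]
    refine (iSup_congr fun α => ?_).trans (ciSup_const (a := κ))
    have hα : α.1 < (succ κ).ord := hh ▸ α.2
    rw [cbLevel, h.cbIdeal_eq hα.le, h.mk_atoms hα, hlev _ hα]

end IsScatteredOrder

/-! ### Positions in sets of ordinals -/

namespace TwoCardinal

section imageOn

variable {A : Type u} [LinearOrder A]

lemma imageOn_self {X Y : Set A} (f : X ≃o Y) : imageOn f X = Y := by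
  ext y
  constructor
  · rintro ⟨x, -, rfl⟩
    exact (f x).2
  · intro hy
    exact ⟨f.symm ⟨y, hy⟩, (f.symm ⟨y, hy⟩).2, by simp⟩

lemma mem_imageOn {X Y : Set A} (f : X ≃o Y) {Z : Set A} (a : X) :
    (f a : A) ∈ imageOn f Z ↔ (a : A) ∈ Z := by
  refine ⟨?_, fun h => ⟨a, h, rfl⟩⟩
  rintro ⟨x, hx, hxa⟩
  rwa [← f.injective (Subtype.ext hxa)]

lemma imageOn_subset_iff {X Y : Set A} (f : X ≃o Y) {Z W : Set A} (hZ : Z ⊆ X) :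
    imageOn f Z ⊆ imageOn f W ↔ Z ⊆ W := by
  refine ⟨fun h a ha => ?_, ?_⟩
  · exact (mem_imageOn f ⟨a, hZ ha⟩).1 (h ⟨⟨a, hZ ha⟩, ha, rfl⟩)
  · rintro h _ ⟨x, hx, rfl⟩
    exact ⟨x, h hx, rfl⟩

lemma imageOn_ssubset_iff {X Y : Set A} (f : X ≃o Y) {Z W : Set A} (hZ : Z ⊆ X) (hW : W ⊆ X) :
    imageOn f Z ⊂ imageOn f W ↔ Z ⊂ W := by
  rw [ssubset_iff_subset_not_subset, ssubset_iff_subset_not_subset, imageOn_subset_iff f hZ,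
    imageOn_subset_iff f hW]

end imageOn

section pos

variable {A : Type u} [LinearOrder A] [WellFoundedLT A]

open scoped Ordinal in
/-- The position of `a` in `X`: the order type of the part of `X` below `a`. -/
noncomputable def pos (X : Set A) (a : A) : Ordinal.{u} := typeLT ↥(X ∩ Set.Iio a)

lemma pos_lt_pos {X : Set A} {a b : A} (ha : a ∈ X) (hab : a < b) : pos X a < pos X b := by
  refine Ordinal.type_lt_iff.2 ⟨⟨⟨⟨fun x => ⟨x.1, x.2.1, lt_trans x.2.2 hab⟩, ?_⟩, ?_⟩,
    ⟨a, ha, hab⟩, ?_⟩⟩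
  · intro x y hxy
    exact Subtype.ext (congrArg (fun z : ↥(X ∩ Set.Iio b) => z.1) hxy)
  · exact Iff.rfl
  · intro x
    constructor
    · rintro ⟨y, rfl⟩
      exact y.2.2
    · intro hx
      exact ⟨⟨x.1, x.2.1, hx⟩, rfl⟩

lemma pos_lt_pos_iff {X : Set A} {a b : A} (ha : a ∈ X) (hb : b ∈ X) :
    pos X a < pos X b ↔ a < b := by
  refine ⟨fun h => ?_, pos_lt_pos ha⟩
  by_contra! hba
  rcases hba.lt_or_eq with hlt | rfl
  · exact lt_asymm h (pos_lt_pos hb hlt)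
  · exact lt_irrefl _ h

lemma pos_inj {X : Set A} {a b : A} (ha : a ∈ X) (hb : b ∈ X) (h : pos X a = pos X b) :
    a = b := by
  rcases lt_trichotomy a b with hab | hab | hab
  · exact absurd h (pos_lt_pos ha hab).ne
  · exact hab
  · exact absurd h (pos_lt_pos hb hab).ne'

lemma pos_congr {X Y : Set A} {a : A} (h : ∀ b < a, b ∈ X ↔ b ∈ Y) : pos X a = pos Y a := by
  have : X ∩ Set.Iio a = Y ∩ Set.Iio a := by
    ext b
    exact and_congr_left (h b)
  unfold pos
  congr!

lemma pos_lt_ord {κ : Cardinal.{u}} {X : Set A} (hX : #X < κ) (a : A) : pos X a < κ.ord := by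
  rw [lt_ord, pos, Ordinal.card_type]
  exact (mk_le_mk_of_subset Set.inter_subset_left).trans_lt hX

/-- Order isomorphisms preserve positions, also relative to subsets. -/
lemma pos_imageOn {X Y : Set A} (f : X ≃o Y) {Z : Set A} (hZ : Z ⊆ X) (a : X) :
    pos (imageOn f Z) (f a) = pos Z a := by
  refine (Ordinal.type_eq.2 ⟨RelIso.mk (Equiv.ofBijective
    (fun x => ⟨f ⟨x.1, hZ x.2.1⟩, ⟨⟨x.1, hZ x.2.1⟩, x.2.1, rfl⟩,
      f.lt_iff_lt.2 (show (⟨x.1, hZ x.2.1⟩ : X) < a from x.2.2)⟩) ⟨?_, ?_⟩) ?_⟩).symm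
  · intro x y hxy
    have h1 := congrArg (fun z : ↥(imageOn f Z ∩ Set.Iio (f a).1) => z.1) hxy
    have h2 := f.injective (Subtype.ext h1)
    exact Subtype.ext (congrArg (fun z : X => z.1) h2)
  · rintro ⟨y, ⟨x, hx, rfl⟩, hy⟩
    exact ⟨⟨x.1, hx, f.lt_iff_lt.1 (show f x < f a from hy)⟩, rfl⟩
  · intro x y
    exact f.lt_iff_lt (x := ⟨x.1, hZ x.2.1⟩) (y := ⟨y.1, hZ y.2.1⟩)

open Classical in
/-- The element of `Y` with the position that `a` has in `X`; for sets of the same order type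
this is the order isomorphism from `X` onto `Y`. -/
noncomputable def transfer (X Y : Set A) (a : A) : A :=
  if h : ∃ b ∈ Y, pos Y b = pos X a then h.choose else a

lemma transfer_eq {X Y : Set A} {a b : A} (hb : b ∈ Y) (h : pos Y b = pos X a) :
    transfer X Y a = b := by
  have hex : ∃ b ∈ Y, pos Y b = pos X a := ⟨b, hb, h⟩
  rw [transfer, dif_pos hex]
  exact pos_inj hex.choose_spec.1 hb (hex.choose_spec.2.trans h.symm)

end pos

/-! ### The rank in a two-cardinal -/

section rank

variable {A : Type u} {μ : Set (Set A)} [WellFoundedLT μ]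

lemma rank_lt {X Y : μ} (h : X < Y) : rank μ X < rank μ Y := WellFoundedLT.rank_strictMono h

lemma rank_mono {X Y : μ} (h : X ≤ Y) : rank μ X ≤ rank μ Y :=
  WellFoundedLT.rank_strictMono.monotone h

lemma eq_of_le_of_rank_eq {X Y : μ} (h : X ≤ Y) (hr : rank μ X = rank μ Y) : X = Y := by
  by_contra hne
  exact (rank_lt (lt_of_le_of_ne h hne)).ne hr

lemma exists_le_rank {o : Ordinal.{u}} {Z : μ} (h : o < rank μ Z) : ∃ Y < Z, o ≤ rank μ Y := by
  rw [rank, IsWellFounded.rank_eq, Ordinal.lt_iSup_iff] at h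
  obtain ⟨Y, hY⟩ := h
  exact ⟨Y.1, Y.2, lt_succ_iff.1 hY⟩

lemma rank_le_of_forall_lt {o : Ordinal.{u}} {Z : μ} (h : ∀ Y < Z, rank μ Y < o) :
    rank μ Z ≤ o := by
  by_contra! hlt
  obtain ⟨Y, hY, ho⟩ := exists_le_rank hlt
  exact (h Y hY).not_ge ho

lemma exists_rank_eq {o : Ordinal.{u}} {Z : μ} (h : o < rank μ Z) : ∃ Y < Z, rank μ Y = o := by
  induction Z using WellFoundedLT.induction with
  | ind Z ih =>
    obtain ⟨Y, hY, ho⟩ := exists_le_rank h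
    rcases ho.eq_or_lt with rfl | ho
    · exact ⟨Y, hY, rfl⟩
    · obtain ⟨W, hW, hWo⟩ := ih Y hY ho
      exact ⟨W, hW.trans hY, hWo⟩

end rank

end TwoCardinal

open TwoCardinal

/-- `Z = Z₁ * Z₂` in `μ`, spelled out: `Z₁ ∩ Z₂` is an initial segment of both `Z₁` and `Z₂`, and
all proper subsets of `Z` in `μ` are included in `Z₁` or in `Z₂`. -/
structure IsSplit {A : Type u} [LinearOrder A] {μ : Set (Set A)} [WellFoundedLT μ]
    (Z Z₁ Z₂ : μ) : Prop where
  lt_left : Z₁ < Z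
  lt_right : Z₂ < Z
  rank_eq : rank μ Z₁ = rank μ Z₂
  rank_top : rank μ Z = rank μ Z₁ + 1
  le_or_le : ∀ Y < Z, Y ≤ Z₁ ∨ Y ≤ Z₂
  mem_or_mem : ∀ a ∈ Z.1, a ∈ Z₁.1 ∨ a ∈ Z₂.1
  initial : ∀ a ∈ Z₁.1, a ∈ Z₂.1 → ∀ b < a, b ∈ Z₁.1 ↔ b ∈ Z₂.1
  lt_of_notMem : ∀ a ∈ Z₁.1, a ∉ Z₂.1 → ∀ b ∈ Z₂.1, b ∉ Z₁.1 → a < b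

namespace IsTwoCardinal

variable {κ : Cardinal.{u}} {μ : Set (Set (SuccCard κ))}

lemma exists_ge_ge (h : IsTwoCardinal κ μ) (X Y : μ) : ∃ Z : μ, X ≤ Z ∧ Y ≤ Z := by
  obtain ⟨Z, hZ, hXZ, hYZ⟩ := h.directed X.1 X.2 Y.1 Y.2
  exact ⟨⟨Z, hZ⟩, hXZ, hYZ⟩

lemma exists_mem (h : IsTwoCardinal κ μ) (a : SuccCard κ) : ∃ Z : μ, a ∈ Z.1 := by
  obtain ⟨Z, hZ, ha⟩ := h.covers.symm ▸ Set.mem_univ a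
  exact ⟨⟨Z, hZ⟩, ha⟩

variable [WellFoundedLT μ]

lemma rank_lt_ord (h : IsTwoCardinal κ μ) (Z : μ) : rank μ Z < κ.ord := by
  rw [lt_ord]
  refine lt_of_le_of_lt ?_ (h.locally_small Z.1 Z.2)
  rw [← Cardinal.mk_toType]
  have hex : ∀ ξ : (rank μ Z).ToType, ∃ Y < Z, rank μ Y = ξ.toOrd.1 :=
    fun ξ => exists_rank_eq ξ.toOrd.2
  choose Y hY hYr using hex
  refine Cardinal.mk_le_of_injective (f := fun ξ => ⟨(Y ξ).1, (Y ξ).2, hY ξ⟩) fun ξ η hξη => ?_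
  have h1 : Y ξ = Y η := Subtype.ext (congrArg (fun z : ↥(below μ Z.1) => z.1) hξη)
  have h2 := congrArg (rank μ) h1
  rw [hYr, hYr] at h2
  exact Ordinal.ToType.mk.symm.injective (Subtype.ext h2)

/-- The traces of `μ` on sets of the same rank correspond under position-preserving maps. -/
lemma exists_transfer (h : IsTwoCardinal κ μ) {Z Z' Y : μ} (hr : rank μ Z = rank μ Z')
    (hY : Y ≤ Z) : ∃ Y' ≤ Z', rank μ Y' = rank μ Y ∧ ∀ a ∈ Z.1,
      (transfer Z.1 Z'.1 a ∈ Y'.1 ↔ a ∈ Y.1) ∧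
      pos Y'.1 (transfer Z.1 Z'.1 a) = pos Y.1 a := by
  obtain ⟨f, hf⟩ := h.homogeneous Z Z' hr
  have htr : ∀ a : Z.1, transfer Z.1 Z'.1 a = f a := fun a => by
    refine transfer_eq (f a).2 ?_
    have := pos_imageOn f subset_rfl a
    rwa [imageOn_self f] at this
  have himg : ∀ W : μ, W < Z → imageOn f W.1 ∈ below μ Z'.1 := fun W hW => by
    rw [hf]
    exact ⟨W.1, ⟨W.2, hW⟩, rfl⟩
  have hrank : ∀ W : μ, W < Z → ∀ W' : μ, W'.1 = imageOn f W.1 → rank μ W' = rank μ W := by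
    intro W
    induction W using WellFoundedLT.induction with
    | ind W ih =>
      intro hW W' hW'
      apply le_antisymm
      · refine rank_le_of_forall_lt fun V' hV' => ?_
        have hV'Z : V'.1 ∈ below μ Z'.1 :=
          ⟨V'.2, lt_trans (b := W'.1) hV' (hW'.symm ▸ (himg W hW).2)⟩
        rw [hf] at hV'Z
        obtain ⟨V, hV, hVV'⟩ := hV'Z
        have hVW : V ⊂ W.1 := by
          rw [← imageOn_ssubset_iff f hV.2.subset hW.le, ← hVV', ← hW']
          exact hV'
        rw [ih ⟨V, hV.1⟩ hVW hV.2 V' hVV']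
        exact rank_lt hVW
      · refine rank_le_of_forall_lt fun V hV => ?_
        have hVZ := hV.trans hW
        rw [← ih V hV hVZ ⟨_, (himg V hVZ).1⟩ rfl]
        refine rank_lt ?_
        change imageOn f V.1 ⊂ W'.1
        rw [hW', imageOn_ssubset_iff f hVZ.le hW.le]
        exact hV
  have hfinal : ∀ Y' : μ, Y'.1 = imageOn f Y.1 → ∀ a ∈ Z.1,
      (transfer Z.1 Z'.1 a ∈ Y'.1 ↔ a ∈ Y.1) ∧
      pos Y'.1 (transfer Z.1 Z'.1 a) = pos Y.1 a := by
    intro Y' hY' a ha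
    rw [htr ⟨a, ha⟩, hY']
    exact ⟨mem_imageOn f ⟨a, ha⟩, pos_imageOn f hY ⟨a, ha⟩⟩
  rcases hY.eq_or_lt with rfl | hlt
  · exact ⟨Z', le_rfl, hr.symm, hfinal Z' (imageOn_self f).symm⟩
  · exact ⟨⟨_, (himg Y hlt).1⟩, (himg Y hlt).2.subset, hrank Y hlt _ rfl, hfinal _ rfl⟩

lemma transfer_mem (h : IsTwoCardinal κ μ) {Z Z' : μ} (hr : rank μ Z = rank μ Z')
    {a : SuccCard κ} (ha : a ∈ Z.1) : transfer Z.1 Z'.1 a ∈ Z'.1 := by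
  obtain ⟨Y', hY', -, hm⟩ := h.exists_transfer hr (le_refl Z)
  exact hY' ((hm a ha).1.2 ha)

lemma pos_transfer (h : IsTwoCardinal κ μ) {Z Z' : μ} (hr : rank μ Z = rank μ Z')
    {a : SuccCard κ} (ha : a ∈ Z.1) : pos Z'.1 (transfer Z.1 Z'.1 a) = pos Z.1 a := by
  obtain ⟨Y', hY', hrY, hm⟩ := h.exists_transfer hr (le_refl Z)
  have := (hm a ha).2
  rwa [eq_of_le_of_rank_eq hY' (hrY.trans hr)] at this

lemma transfer_transfer (h : IsTwoCardinal κ μ) {Z Z' : μ} (hr : rank μ Z = rank μ Z')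
    {a : SuccCard κ} (ha : a ∈ Z.1) : transfer Z'.1 Z.1 (transfer Z.1 Z'.1 a) = a :=
  transfer_eq ha (h.pos_transfer hr ha).symm

lemma transfer_lt_transfer (h : IsTwoCardinal κ μ) {Z Z' : μ} (hr : rank μ Z = rank μ Z')
    {a b : SuccCard κ} (ha : a ∈ Z.1) (hb : b ∈ Z.1) (hab : a < b) :
    transfer Z.1 Z'.1 a < transfer Z.1 Z'.1 b := by
  rw [← pos_lt_pos_iff (h.transfer_mem hr ha) (h.transfer_mem hr hb), h.pos_transfer hr ha,
    h.pos_transfer hr hb]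
  exact pos_lt_pos ha hab

/-- Every member of `μ` is directed or splits. -/
lemma directed_or_isSplit (h : IsTwoCardinal κ μ) (Z : μ) :
    (∀ X < Z, ∀ Y < Z, ∃ W < Z, X ≤ W ∧ Y ≤ W) ∨ ∃ Z₁ Z₂ : μ, IsSplit Z Z₁ Z₂ := by
  rcases h.locally_almost_directed Z.1 Z.2 with hd | ⟨Z₁, Z₂, hr, ⟨-, hlt, hlt', hZ⟩, hb⟩
  · left
    intro X hX Y hY
    obtain ⟨W, hW, hXW, hYW⟩ := hd X.1 ⟨X.2, hX⟩ Y.1 ⟨Y.2, hY⟩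
    exact ⟨⟨W, hW.1⟩, hW.2, hXW, hYW⟩
  right
  have h1 : Z₁ < Z := by
    have : Z₁.1 ∈ below μ Z.1 := by rw [hb]; simp
    exact this.2
  have h2 : Z₂ < Z := by
    have : Z₂.1 ∈ below μ Z.1 := by rw [hb]; simp
    exact this.2
  have hcase : ∀ Y < Z, Y ≤ Z₁ ∨ Y ≤ Z₂ := by
    intro Y hY
    have hYZ : Y.1 ∈ below μ Z.1 := ⟨Y.2, hY⟩
    rw [hb] at hYZ
    rcases hYZ with (hY1 | hY2) | (hY1 | hY2)
    · exact Or.inl hY1.2.subset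
    · exact Or.inr hY2.2.subset
    · exact Or.inl (le_of_eq (Subtype.ext hY1))
    · exact Or.inr (le_of_eq (Subtype.ext hY2))
  -- `Z₁ \ Z₂` is nonempty, since otherwise `Z₁ = Z₂ = Z`
  obtain ⟨c, hc1, hc2⟩ : ∃ c ∈ Z₁.1, c ∉ Z₂.1 := by
    by_contra! hsub
    have hle : Z₁ ≤ Z₂ := hsub
    have heq : Z₁ = Z₂ := eq_of_le_of_rank_eq hle hr
    refine h1.ne (Subtype.ext ?_)
    rw [hZ, ← heq, Set.union_self]
  refine ⟨Z₁, Z₂, h1, h2, hr, ?_, hcase, ?_, ?_, ?_⟩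
  · refine le_antisymm (rank_le_of_forall_lt fun Y hY => ?_) (succ_le_of_lt (rank_lt h1))
    rw [lt_add_one_iff]
    rcases hcase Y hY with hY | hY
    · exact rank_mono hY
    · exact (rank_mono hY).trans hr.ge
  · intro a ha
    rwa [hZ] at ha
  · intro a ha1 ha2 b hb
    constructor
    · intro hb1
      by_contra hb2
      exact lt_asymm hb (hlt a ⟨ha1, ha2⟩ b ⟨hb1, hb2⟩)
    · intro hb2
      by_contra hb1
      exact lt_asymm hb ((hlt a ⟨ha1, ha2⟩ c ⟨hc1, hc2⟩).trans (hlt' c ⟨hc1, hc2⟩ b ⟨hb2, hb1⟩))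
  · exact fun a ha1 ha2 b hb2 hb1 => hlt' a ⟨ha1, ha2⟩ b ⟨hb2, hb1⟩

lemma transfer_eq_self_of_isSplit {Z Z₁ Z₂ : μ} (hs : IsSplit Z Z₁ Z₂) {a : SuccCard κ}
    (ha1 : a ∈ Z₁.1) (ha2 : a ∈ Z₂.1) : transfer Z₂.1 Z₁.1 a = a :=
  transfer_eq ha1 (pos_congr (hs.initial a ha1 ha2))

/-- Coherence: the common elements of two sets of the same rank form an initial segment of both. -/
lemma mem_iff_of_rank_eq (h : IsTwoCardinal κ μ) {X Y : μ} (hr : rank μ X = rank μ Y)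
    {a b : SuccCard κ} (haX : a ∈ X.1) (haY : a ∈ Y.1) (hb : b < a) : b ∈ X.1 ↔ b ∈ Y.1 := by
  obtain ⟨Z, hXZ, hYZ⟩ := h.exists_ge_ge X Y
  induction Z using WellFoundedLT.induction generalizing X Y with
  | ind Z ih =>
    rcases hXZ.eq_or_lt with rfl | hXlt
    · rw [eq_of_le_of_rank_eq hYZ hr.symm]
    rcases hYZ.eq_or_lt with rfl | hYlt
    · exact absurd hr (rank_lt hXlt).ne
    rcases h.directed_or_isSplit Z with hd | ⟨Z₁, Z₂, hs⟩
    · obtain ⟨W, hW, hXW, hYW⟩ := hd X hXlt Y hYlt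
      exact ih W hW hr haX haY hXW hYW
    have key : ∀ X Y : μ, rank μ X = rank μ Y → a ∈ X.1 → a ∈ Y.1 → X ≤ Z₁ → Y ≤ Z₂ →
        (b ∈ X.1 ↔ b ∈ Y.1) := by
      intro X Y hr haX haY hX hY
      have ha1 := hX haX
      have ha2 := hY haY
      obtain ⟨Y', hY', hrY, hm⟩ := h.exists_transfer hs.rank_eq.symm hY
      have haY' : a ∈ Y'.1 := by
        have := (hm a ha2).1.2 haY
        rwa [transfer_eq_self_of_isSplit hs ha1 ha2] at this
      rw [ih Z₁ hs.lt_left (hr.trans hrY.symm) haX haY' hX hY']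
      by_cases hb1 : b ∈ Z₁.1
      · have hb2 := (hs.initial a ha1 ha2 b hb).1 hb1
        rw [← (hm b hb2).1, transfer_eq_self_of_isSplit hs hb1 hb2]
      · have hb2 := fun hb2 => hb1 ((hs.initial a ha1 ha2 b hb).2 hb2)
        exact iff_of_false (fun hb => hb1 (hY' hb)) fun hb => hb2 (hY hb)
    rcases hs.le_or_le X hXlt with hX | hX <;> rcases hs.le_or_le Y hYlt with hY | hY
    · exact ih Z₁ hs.lt_left hr haX haY hX hY
    · exact key X Y hr haX haY hX hY
    · exact (key Y X hr.symm haY haX hY hX).symm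
    · exact ih Z₂ hs.lt_right hr haX haY hX hY

/-- The ranks are unbounded in `κ`: an initial segment of size `κ` is the union of the traces of
sets containing its top element, and there is only one such trace of each rank. -/
lemma exists_rank_ge (h : IsTwoCardinal κ μ) (hκ : κ.IsRegular) {o : Ordinal.{u}}
    (ho : o < κ.ord) : ∃ Z : μ, o ≤ rank μ Z := by
  by_contra! hlt
  obtain ⟨g⟩ : Nonempty (κ.ord.ToType <i SuccCard κ) := by
    rw [← Ordinal.type_lt_iff, Ordinal.type_toType, Ordinal.type_toType]
    exact ord_lt_ord.2 (lt_succ κ)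
  let a : SuccCard κ := g.top
  let S : o.ToType → Set (SuccCard κ) := fun ξ =>
    {b | b < a ∧ ∃ Z : μ, a ∈ Z.1 ∧ b ∈ Z.1 ∧ rank μ Z = ξ.toOrd.1}
  have hS : ∀ ξ, #(S ξ) < κ := by
    intro ξ
    by_cases hex : ∃ Z : μ, a ∈ Z.1 ∧ rank μ Z = ξ.toOrd.1
    · obtain ⟨Z, ha, hZ⟩ := hex
      refine (mk_le_mk_of_subset ?_).trans_lt (h.card_lt Z.1 Z.2)
      rintro b ⟨hba, Z', ha', hb, hZ'⟩
      exact (h.mem_iff_of_rank_eq (hZ'.trans hZ.symm) ha' ha hba).1 hb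
    · have : S ξ = ∅ := Set.eq_empty_of_forall_notMem fun b ⟨_, Z, ha, _, hZ⟩ => hex ⟨Z, ha, hZ⟩
      rw [this, mk_eq_zero]
      exact hκ.pos
  have hU : #(⋃ ξ, S ξ) < κ := by
    refine (card_iUnion_lt_iff_forall_of_isRegular hκ ?_).2 hS
    rw [mk_toType]
    exact lt_ord.1 ho
  refine hU.not_ge ?_
  refine (mk_ord_toType κ).ge.trans (mk_le_of_injective (f := fun x => ⟨g x, ?_⟩) fun x y hxy => ?_)
  · obtain ⟨Z₁, hZ₁⟩ := h.exists_mem (g x)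
    obtain ⟨Z₂, hZ₂⟩ := h.exists_mem a
    obtain ⟨Z, h1, h2⟩ := h.exists_ge_ge Z₁ Z₂
    refine Set.mem_iUnion.2 ⟨Ordinal.ToType.mk ⟨rank μ Z, hlt Z⟩, g.lt_top x, Z, h2 hZ₂, h1 hZ₁, ?_⟩
    rw [Ordinal.ToType.toOrd, OrderIso.symm_apply_apply]
  · exact g.injective (congrArg (fun z : ↥(⋃ ξ, S ξ) => z.1) hxy)

end IsTwoCardinal

/-! ### Points and their order -/

namespace TwoCardinal

/-- The points of the scattered space. A point consists of an element of `κ⁺`, its level, and a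
name. A point with name `(ξ, γ) :: s` appears in a set `Z` of `μ` of rank `ξ`, as a new point below
the point of `Z` with name `s` whose level is the element of `Z` at position `γ`. The name `[]` is
that of the points that are present from the start. -/
structure Point (κ : Cardinal.{u}) : Type u where
  /-- The level of the point. -/
  base : SuccCard κ
  /-- The name of the point. -/
  name : List (κ.ord.ToType × κ.ord.ToType)

/-- The level of a point as an ordinal. -/
noncomputable def Point.level {κ : Cardinal.{u}} (p : Point κ) : Ordinal.{u} := p.base.toOrd.1

/-- The points with a given name are old in sets of rank at least the age of the name. -/
noncomputable def age {κ : Cardinal.{u}} : List (κ.ord.ToType × κ.ord.ToType) → Ordinal.{u}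
  | [] => 0
  | p :: _ => p.1.toOrd.1 + 1

section Edges

variable {κ : Cardinal.{u}} {μ : Set (Set (SuccCard κ))} [WellFoundedLT μ]

/-- The points that exist in `Z` before the new points of `Z` are added. -/
def Old (Z : μ) (p : Point κ) : Prop := p.base ∈ Z.1 ∧ age p.name ≤ rank μ Z

/-- The points that exist in `Z`, including the new ones. -/
def Present (Z : μ) (p : Point κ) : Prop := p.base ∈ Z.1 ∧ age p.name ≤ rank μ Z + 1

/-- `p` is one of the new points of `Y`, added immediately below the old point `q`. -/
def IsChild (Y : μ) (p q : Point κ) : Prop :=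
  p.base ∈ Y.1 ∧ q.base ∈ Y.1 ∧ p.base < q.base ∧ age q.name ≤ rank μ Y ∧
    ∃ ξ γ, p.name = (ξ, γ) :: q.name ∧ ξ.toOrd.1 = rank μ Y ∧ γ.toOrd.1 = pos Y.1 q.base

/-- `Y` is the amalgam of two sets of the same rank, and `q` is the copy in one of them of the
lower point `p` of the other one. -/
def IsCopy (Y : μ) (p q : Point κ) : Prop :=
  ∃ Y₁ < Y, ∃ Y₂ < Y, rank μ Y₁ = rank μ Y₂ ∧ rank μ Y = rank μ Y₁ + 1 ∧
    p.base ∈ Y₁.1 ∧ q.base ∈ Y₂.1 ∧ p.base < q.base ∧ pos Y₁.1 p.base = pos Y₂.1 q.base ∧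
    p.name = q.name ∧ age p.name ≤ rank μ Y

/-- The relations between points that are imposed inside `Z`. -/
def Edge (Z : μ) (p q : Point κ) : Prop := ∃ Y ≤ Z, IsChild Y p q ∨ IsCopy Y p q

/-- The relations between the old points of `Z`. -/
def OldEdge (Z : μ) (p q : Point κ) : Prop := (∃ Y < Z, Edge Y p q) ∨ IsCopy Z p q

/-- The order of the points of `Z`. -/
def LeIn (Z : μ) : Point κ → Point κ → Prop := Relation.ReflTransGen (Edge Z)

/-- The order of the old points of `Z`. -/
def OldLe (Z : μ) : Point κ → Point κ → Prop := Relation.ReflTransGen (OldEdge Z)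

lemma Old.mono {Y Z : μ} (hYZ : Y ≤ Z) {p : Point κ} (h : Old Y p) : Old Z p :=
  ⟨hYZ h.1, h.2.trans (rank_mono hYZ)⟩

lemma Present.mono {Y Z : μ} (hYZ : Y ≤ Z) {p : Point κ} (h : Present Y p) : Present Z p :=
  ⟨hYZ h.1, h.2.trans (add_le_add_left (rank_mono hYZ) 1)⟩

lemma Present.old {Y Z : μ} (hYZ : Y < Z) {p : Point κ} (h : Present Y p) : Old Z p :=
  ⟨hYZ.le h.1, h.2.trans (add_one_le_of_lt (rank_lt hYZ))⟩

lemma Old.present {Z : μ} {p : Point κ} (h : Old Z p) : Present Z p :=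
  ⟨h.1, h.2.trans (le_add_of_nonneg_right zero_le_one)⟩

lemma IsChild.age_eq {Y : μ} {p q : Point κ} (h : IsChild Y p q) :
    age p.name = rank μ Y + 1 := by
  obtain ⟨-, -, -, -, ξ, γ, hp, hξ, -⟩ := h
  rw [hp, age, hξ]

lemma IsChild.unique {Y : μ} {p q q' : Point κ} (h : IsChild Y p q) (h' : IsChild Y p q') :
    q = q' := by
  obtain ⟨-, hq, -, -, ξ, γ, hp, -, hγ⟩ := h
  obtain ⟨-, hq', -, -, ξ', γ', hp', -, hγ'⟩ := h'
  rw [hp, List.cons.injEq, Prod.mk.injEq] at hp'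
  obtain ⟨⟨rfl, rfl⟩, hn⟩ := hp'
  have hb := pos_inj hq hq' (hγ.symm.trans hγ')
  cases q
  cases q'
  simp_all

lemma Edge.mono {Y Z : μ} (hYZ : Y ≤ Z) {p q : Point κ} (h : Edge Y p q) : Edge Z p q := by
  obtain ⟨W, hW, h⟩ := h
  exact ⟨W, hW.trans hYZ, h⟩

lemma Edge.base_lt {Z : μ} {p q : Point κ} (h : Edge Z p q) : p.base < q.base := by
  obtain ⟨Y, -, (h | ⟨Y₁, -, Y₂, -, -, -, -, -, h, -⟩)⟩ := h
  · exact h.2.2.1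
  · exact h

lemma Edge.old_right {Z : μ} {p q : Point κ} (h : Edge Z p q) : Old Z q := by
  obtain ⟨Y, hY, (h | ⟨Y₁, -, Y₂, h2, -, -, -, hq, -, -, hn, ha⟩)⟩ := h
  · exact Old.mono hY ⟨h.2.1, h.2.2.2.1⟩
  · exact Old.mono hY ⟨h2.le hq, hn ▸ ha⟩

lemma Edge.present_left {Z : μ} {p q : Point κ} (h : Edge Z p q) : Present Z p := by
  obtain ⟨Y, hY, (h | ⟨Y₁, h1, Y₂, -, -, -, hp, -, -, -, -, ha⟩)⟩ := h
  · exact Present.mono hY ⟨h.1, h.age_eq.le⟩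
  · exact (Old.mono hY ⟨h1.le hp, ha⟩).present

lemma OldEdge.old_left {Z : μ} {p q : Point κ} (h : OldEdge Z p q) : Old Z p := by
  rcases h with ⟨Y, hY, h⟩ | ⟨Y₁, h1, Y₂, -, -, -, hp, -, -, -, -, ha⟩
  · exact h.present_left.old hY
  · exact ⟨h1.le hp, ha⟩

lemma Edge.oldEdge_or_isChild {Z : μ} {p q : Point κ} (h : Edge Z p q) :
    OldEdge Z p q ∨ IsChild Z p q := by
  obtain ⟨Y, hY, h⟩ := h
  rcases hY.eq_or_lt with rfl | hlt
  · exact h.symm.imp Or.inr id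
  · exact Or.inl (Or.inl ⟨Y, hlt, Y, le_rfl, h⟩)

lemma IsChild.edge {Z : μ} {p q : Point κ} (h : IsChild Z p q) : Edge Z p q :=
  ⟨Z, le_rfl, Or.inl h⟩

lemma IsChild.not_old {Z : μ} {p q : Point κ} (h : IsChild Z p q) : ¬ Old Z p := fun hp =>
  (hp.2.trans_lt (lt_succ _)).ne h.age_eq

lemma LeIn.mono {Y Z : μ} (hYZ : Y ≤ Z) {p q : Point κ} (h : LeIn Y p q) : LeIn Z p q :=
  Relation.ReflTransGen.mono (fun _ _ => Edge.mono hYZ) _ _ h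

lemma LeIn.eq_or_base_lt {Z : μ} {p q : Point κ} (h : LeIn Z p q) :
    p = q ∨ p.base < q.base := by
  induction h with
  | refl => exact Or.inl rfl
  | tail _ h ih =>
    rcases ih with rfl | ih
    · exact Or.inr h.base_lt
    · exact Or.inr (ih.trans h.base_lt)

lemma LeIn.present {Z : μ} {p q : Point κ} (h : LeIn Z p q) (hq : Present Z q) :
    Present Z p := by
  rcases h.cases_head with rfl | ⟨c, hc, -⟩
  · exact hq
  · exact hc.present_left

lemma LeIn.oldLe {Z : μ} {p q : Point κ} (h : LeIn Z p q) (hp : Old Z p) : OldLe Z p q := by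
  induction h using Relation.ReflTransGen.head_induction_on with
  | refl => exact .refl
  | head hac _ ih =>
    rcases hac.oldEdge_or_isChild with hac' | hac'
    · exact (ih hac.old_right).head hac'
    · exact absurd hp hac'.not_old

/-- New points have nothing below them. -/
lemma LeIn.eq_of_not_old {Z : μ} {p q : Point κ} (h : LeIn Z p q) (hq : ¬ Old Z q) : p = q := by
  rcases h.cases_tail with rfl | ⟨c, -, hc⟩
  · rfl
  · exact absurd hc.old_right hq

/-- What lies above a new point lies above its parent. -/
lemma LeIn.eq_or_exists_isChild {Z : μ} {p q : Point κ} (h : LeIn Z p q) (hp : ¬ Old Z p) :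
    p = q ∨ ∃ c, IsChild Z p c ∧ LeIn Z c q := by
  rcases h.cases_head with rfl | ⟨c, hc, hcq⟩
  · exact Or.inl rfl
  · rcases hc.oldEdge_or_isChild with hc' | hc'
    · exact absurd hc'.old_left hp
    · exact Or.inr ⟨c, hc', hcq⟩

lemma OldLe.exists_leIn_of_directed {Z : μ} (hd : ∀ X < Z, ∀ Y < Z, ∃ W < Z, X ≤ W ∧ Y ≤ W)
    {Y : μ} (hY : Y < Z) {p q : Point κ} (h : OldLe Z p q) : ∃ W < Z, Y ≤ W ∧ LeIn W p q := by
  induction h with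
  | refl => exact ⟨Y, hY, le_rfl, .refl⟩
  | tail _ he ih =>
    obtain ⟨W, hW, hYW, hle⟩ := ih
    rcases he with ⟨X, hX, he⟩ | ⟨Y₁, h1, Y₂, h2, hr, hZ, hp, hq, hlt, hpos, -⟩
    · obtain ⟨V, hV, hWV, hXV⟩ := hd W hW X hX
      exact ⟨V, hV, hYW.trans hWV, (hle.mono hWV).tail (he.mono hXV)⟩
    -- a directed set is not an amalgam of two sets of maximal rank below it
    · obtain ⟨V, hV, h1V, h2V⟩ := hd Y₁ h1 Y₂ h2
      have hVr : rank μ V ≤ rank μ Y₁ := lt_add_one_iff.1 (hZ ▸ rank_lt hV)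
      have e1 := eq_of_le_of_rank_eq h1V (le_antisymm (rank_mono h1V) hVr)
      have e2 := eq_of_le_of_rank_eq h2V (le_antisymm (rank_mono h2V) (hVr.trans hr.le))
      rw [e1] at hp hpos
      rw [e2] at hq hpos
      exact absurd (pos_inj hp hq hpos) hlt.ne

/-- Transfer of points along the order isomorphism from `Z` onto `Z'`. -/
noncomputable def transferPoint (Z Z' : Set (SuccCard κ)) (p : Point κ) : Point κ :=
  ⟨transfer Z Z' p.base, p.name⟩

end Edges

end TwoCardinal

namespace IsTwoCardinal

variable {κ : Cardinal.{u}} {μ : Set (Set (SuccCard κ))} [WellFoundedLT μ]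

lemma transferPoint_transferPoint (h : IsTwoCardinal κ μ) {Z Z' : μ}
    (hr : rank μ Z = rank μ Z') {p : Point κ} (hp : p.base ∈ Z.1) :
    transferPoint Z'.1 Z.1 (transferPoint Z.1 Z'.1 p) = p := by
  rw [transferPoint, transferPoint, h.transfer_transfer hr hp]

lemma transferPoint_present (h : IsTwoCardinal κ μ) {Z Z' : μ}
    (hr : rank μ Z = rank μ Z') {p : Point κ} (hp : Present Z p) :
    Present Z' (transferPoint Z.1 Z'.1 p) :=
  ⟨h.transfer_mem hr hp.1, hr ▸ hp.2⟩

/-- Homogeneity of the relations between points. -/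
lemma edge_transferPoint (h : IsTwoCardinal κ μ) {Z Z' : μ} (hr : rank μ Z = rank μ Z')
    {p q : Point κ} (he : Edge Z p q) :
    Edge Z' (transferPoint Z.1 Z'.1 p) (transferPoint Z.1 Z'.1 q) := by
  have hlt := h.transfer_lt_transfer hr he.present_left.1 he.old_right.1 he.base_lt
  obtain ⟨Y, hY, he⟩ := he
  obtain ⟨Y', hY', hrY, hm⟩ := h.exists_transfer hr hY
  refine ⟨Y', hY', ?_⟩
  rcases he with ⟨hp, hq, -, ha, ξ, γ, hn, hξ, hγ⟩ |
    ⟨Y₁, h1, Y₂, h2, hr12, hr1, hp, hq, -, hpos, hn, ha⟩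
  · refine Or.inl ⟨(hm _ (hY hp)).1.2 hp, (hm _ (hY hq)).1.2 hq, hlt, hrY ▸ ha, ξ, γ, hn,
      hξ.trans hrY.symm, hγ.trans (hm _ (hY hq)).2.symm⟩
  · have htr : ∀ a ∈ Y.1, transfer Y.1 Y'.1 a = transfer Z.1 Z'.1 a := fun a ha =>
      transfer_eq ((hm a (hY ha)).1.2 ha) (hm a (hY ha)).2
    obtain ⟨Y₁', h1', hrY1, hm1⟩ := h.exists_transfer hrY.symm h1.le
    obtain ⟨Y₂', h2', hrY2, hm2⟩ := h.exists_transfer hrY.symm h2.le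
    have hpY := h1.le hp
    have hqY := h2.le hq
    have hm1p := hm1 _ hpY
    have hm2q := hm2 _ hqY
    rw [htr _ hpY] at hm1p
    rw [htr _ hqY] at hm2q
    refine Or.inr ⟨Y₁', lt_of_le_of_ne h1' ?_, Y₂', lt_of_le_of_ne h2' ?_,
      hrY1.trans (hr12.trans hrY2.symm), by rw [hrY, hrY1, hr1], hm1p.1.2 hp, hm2q.1.2 hq, hlt,
      hm1p.2.trans (hpos.trans hm2q.2.symm), hn, hrY ▸ ha⟩
    · rintro rfl
      exact (rank_lt h1).ne (hrY1.symm.trans hrY)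
    · rintro rfl
      exact (rank_lt h2).ne (hrY2.symm.trans hrY)

lemma leIn_transferPoint (h : IsTwoCardinal κ μ) {Z Z' : μ} (hr : rank μ Z = rank μ Z')
    {p q : Point κ} (he : LeIn Z p q) :
    LeIn Z' (transferPoint Z.1 Z'.1 p) (transferPoint Z.1 Z'.1 q) :=
  Relation.ReflTransGen.lift (transferPoint Z.1 Z'.1) (fun _ _ => h.edge_transferPoint hr) _ _ he

end IsTwoCardinal

/-! ### The order of an amalgam -/

namespace TwoCardinal

open Classical in
/-- The retraction of the old points of `Z₁ * Z₂` onto those of `Z₁`. -/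
noncomputable def retract {κ : Cardinal.{u}} (Z₁ Z₂ : Set (SuccCard κ)) (p : Point κ) : Point κ :=
  if p.base ∈ Z₁ then p else transferPoint Z₂ Z₁ p

lemma retract_left {κ : Cardinal.{u}} {Z₁ Z₂ : Set (SuccCard κ)} {p : Point κ}
    (hp : p.base ∈ Z₁) : retract Z₁ Z₂ p = p := if_pos hp

end TwoCardinal

namespace IsSplit

variable {κ : Cardinal.{u}} {μ : Set (Set (SuccCard κ))} [WellFoundedLT μ] {Z Z₁ Z₂ : μ}

lemma retract_right (hs : IsSplit Z Z₁ Z₂) {p : Point κ} (hp : p.base ∈ Z₂.1) :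
    retract Z₁.1 Z₂.1 p = transferPoint Z₂.1 Z₁.1 p := by
  by_cases hp1 : p.base ∈ Z₁.1
  · rw [retract_left hp1, transferPoint,
      IsTwoCardinal.transfer_eq_self_of_isSplit hs hp1 hp]
  · exact if_neg hp1

/-- The pair of sets in a copy relation of `Z₁ * Z₂` is the pair `Z₁`, `Z₂`. -/
lemma of_isCopy (hs : IsSplit Z Z₁ Z₂) {p q : Point κ} (hc : IsCopy Z p q) :
    p.base ∈ Z₁.1 ∧ q.base ∈ Z₂.1 ∧ retract Z₁.1 Z₂.1 q = p := by
  obtain ⟨Y₁, h1, Y₂, h2, hr, hZ, hp, hq, hlt, hpos, hn, -⟩ := hc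
  have hr1 : rank μ Y₁ = rank μ Z₁ := by
    have := hZ.symm.trans hs.rank_top
    rw [← succ_eq_add_one, ← succ_eq_add_one] at this
    exact succ_injective this
  have heq : ∀ Y < Z, rank μ Y = rank μ Z₁ → Y = Z₁ ∨ Y = Z₂ := by
    intro Y hY hYr
    rcases hs.le_or_le Y hY with hle | hle
    · exact Or.inl (eq_of_le_of_rank_eq hle hYr)
    · exact Or.inr (eq_of_le_of_rank_eq hle (hYr.trans hs.rank_eq))
  rcases heq Y₁ h1 hr1 with rfl | rfl <;> rcases heq Y₂ h2 (hr.symm.trans hr1) with rfl | rfl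
  · exact absurd (pos_inj hp hq hpos) hlt.ne
  · refine ⟨hp, hq, ?_⟩
    rw [hs.retract_right hq, transferPoint, transfer_eq hp hpos, ← hn]
  -- `p` in `Z₂` and `q` in `Z₁` contradicts `p < q`
  · exfalso
    by_cases hq2 : q.base ∈ Y₁.1
    · have := pos_congr (hs.initial _ hq hq2)
      exact hlt.ne (pos_inj hp hq2 (hpos.trans this))
    by_cases hp1 : p.base ∈ Y₂.1
    · have := pos_congr (hs.initial _ hp1 hp)
      exact hlt.ne (pos_inj hp1 hq (this.trans hpos))
    · exact lt_asymm hlt (hs.lt_of_notMem _ hq hq2 _ hp hp1)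
  · exact absurd (pos_inj hp hq hpos) hlt.ne

/-- The retraction onto `Z₁` preserves the order. -/
lemma leIn_retract (hs : IsSplit Z Z₁ Z₂) (h : IsTwoCardinal κ μ) {p q : Point κ}
    (hle : OldLe Z p q) : LeIn Z₁ (retract Z₁.1 Z₂.1 p) (retract Z₁.1 Z₂.1 q) := by
  induction hle with
  | refl => exact .refl
  | tail _ he ih =>
    refine ih.trans ?_
    rcases he with ⟨Y, hY, he⟩ | hc
    · rcases hs.le_or_le Y hY with hle | hle
      · have he1 := he.mono hle
        rw [retract_left he1.present_left.1, retract_left he1.old_right.1]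
        exact .single he1
      · have he2 := he.mono hle
        rw [hs.retract_right he2.present_left.1, hs.retract_right he2.old_right.1]
        exact .single (h.edge_transferPoint hs.rank_eq.symm he2)
    · obtain ⟨hp, hq, hpq⟩ := hs.of_isCopy hc
      rw [hpq, retract_left hp]

/-- Above a point outside `Z₁` the order is that of `Z₂`. -/
lemma leIn_right (hs : IsSplit Z Z₁ Z₂) {p q : Point κ} (hp : p.base ∉ Z₁.1)
    (hle : OldLe Z p q) : LeIn Z₂ p q ∧ q.base ∉ Z₁.1 := by
  induction hle with
  | refl => exact ⟨.refl, hp⟩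
  | tail _ he ih =>
    obtain ⟨ih, hb⟩ := ih
    rcases he with ⟨Y, hY, he⟩ | hc
    · rcases hs.le_or_le Y hY with hle | hle
      · exact absurd (he.mono hle).present_left.1 hb
      · have he2 := he.mono hle
        refine ⟨ih.tail he2, fun hq => hb ?_⟩
        exact (hs.initial _ hq he2.old_right.1 _ he2.base_lt).2 he2.present_left.1
    · exact absurd (hs.of_isCopy hc).1 hb

/-- A point of `Z₂` lies above its copy in `Z₁`. -/
lemma retract_leIn (hs : IsSplit Z Z₁ Z₂) (h : IsTwoCardinal κ μ) {p : Point κ}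
    (hp : Present Z₂ p) : LeIn Z (retract Z₁.1 Z₂.1 p) p := by
  by_cases hp1 : p.base ∈ Z₁.1
  · rw [retract_left hp1]
    exact .refl
  rw [hs.retract_right hp.1]
  have hmem := h.transfer_mem hs.rank_eq.symm hp.1
  have hpos := h.pos_transfer hs.rank_eq.symm hp.1
  refine .single ⟨Z, le_rfl, Or.inr ⟨Z₁, hs.lt_left, Z₂, hs.lt_right, hs.rank_eq, hs.rank_top,
    hmem, hp.1, hs.lt_of_notMem _ hmem (fun h2 => hp1 ?_) _ hp.1 hp1, hpos, rfl, ?_⟩⟩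
  · have := pos_congr (hs.initial _ hmem h2)
    rwa [pos_inj h2 hp.1 (this.symm.trans hpos)] at hmem
  · rw [hs.rank_top, hs.rank_eq]
    exact hp.2

end IsSplit

/-! ### Coherence of the order and finite meets -/

namespace IsTwoCardinal

variable {κ : Cardinal.{u}} {μ : Set (Set (SuccCard κ))} [WellFoundedLT μ]

/-- The order of the points of `Y` is not changed in larger sets. -/
lemma leIn_restrict (h : IsTwoCardinal κ μ) {Y Z : μ} (hYZ : Y ≤ Z) {p q : Point κ}
    (hp : Present Y p) (hq : Present Y q) (hle : LeIn Z p q) : LeIn Y p q := by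
  induction Z using WellFoundedLT.induction with
  | ind Z ih =>
    rcases hYZ.eq_or_lt with rfl | hlt
    · exact hle
    have hold := hle.oldLe (hp.old hlt)
    rcases h.directed_or_isSplit Z with hd | ⟨Z₁, Z₂, hs⟩
    · obtain ⟨W, hW, hYW, hleW⟩ := hold.exists_leIn_of_directed hd hlt
      exact ih W hW hYW hleW
    · have hle1 := hs.leIn_retract h hold
      rcases hs.le_or_le Y hlt with hY | hY
      · rw [retract_left (hY hp.1), retract_left (hY hq.1)] at hle1
        exact ih Z₁ hs.lt_left hY hle1
      · rw [hs.retract_right (hY hp.1), hs.retract_right (hY hq.1)] at hle1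
        have hle2 := h.leIn_transferPoint hs.rank_eq hle1
        rw [h.transferPoint_transferPoint hs.rank_eq.symm (hY hp.1),
          h.transferPoint_transferPoint hs.rank_eq.symm (hY hq.1)] at hle2
        exact ih Z₂ hs.lt_right hY hle2

end IsTwoCardinal

namespace TwoCardinal

variable {κ : Cardinal.{u}} {μ : Set (Set (SuccCard κ))} [WellFoundedLT μ]

/-- All common lower bounds of `x` and `y` among the points of `Z` lie below members of `F`. -/
def CoversMeet (Z : μ) (F : Set (Point κ)) (x y : Point κ) : Prop :=
  ∀ u, LeIn Z u x → LeIn Z u y → ∃ v ∈ F, LeIn Z u v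

/-- It is enough to consider old lower bounds of old points, because a new point has the same
points above it as its parent. -/
lemma coversMeet_of_old {Z : μ} {F : Set (Point κ)} {x y : Point κ} (hx : Old Z x)
    (hy : Old Z y) (hF : ∀ u, Old Z u → OldLe Z u x → OldLe Z u y → ∃ v ∈ F, LeIn Z u v) :
    CoversMeet Z F x y := by
  intro u hux huy
  by_cases hu : Old Z u
  · exact hF u hu (hux.oldLe hu) (huy.oldLe hu)
  rcases hux.eq_or_exists_isChild hu with rfl | ⟨c, hc, hcx⟩
  · exact absurd hx hu
  rcases huy.eq_or_exists_isChild hu with rfl | ⟨c', hc', hcy⟩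
  · exact absurd hy hu
  obtain rfl := hc.unique hc'
  have hco := hc.edge.old_right
  obtain ⟨v, hv, hcv⟩ := hF c hco (hcx.oldLe hco) (hcy.oldLe hco)
  exact ⟨v, hv, hcv.head hc.edge⟩

end TwoCardinal

namespace IsTwoCardinal

variable {κ : Cardinal.{u}} {μ : Set (Set (SuccCard κ))} [WellFoundedLT μ]

/-- Finite sets generating the common lower bounds remain so in larger sets. -/
lemma coversMeet_mono (h : IsTwoCardinal κ μ) {Y Z : μ} (hYZ : Y ≤ Z) {F : Set (Point κ)}
    {x y : Point κ} (hx : Present Y x) (hy : Present Y y) (hF : ∀ v ∈ F, Present Y v)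
    (hc : CoversMeet Y F x y) : CoversMeet Z F x y := by
  induction Z using WellFoundedLT.induction with
  | ind Z ih =>
    rcases hYZ.eq_or_lt with rfl | hlt
    · exact hc
    refine coversMeet_of_old (hx.old hlt) (hy.old hlt) fun u hu hux huy => ?_
    rcases h.directed_or_isSplit Z with hd | ⟨Z₁, Z₂, hs⟩
    · obtain ⟨W, hW, hYW, hWx⟩ := hux.exists_leIn_of_directed hd hlt
      obtain ⟨V, hV, hWV, hVy⟩ := huy.exists_leIn_of_directed hd hW
      obtain ⟨v, hv, huv⟩ := ih V hV (hYW.trans hWV) u (hWx.mono hWV) hVy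
      exact ⟨v, hv, huv.mono hV.le⟩
    · have hux1 := hs.leIn_retract h hux
      have huy1 := hs.leIn_retract h huy
      rcases hs.le_or_le Y hlt with hY | hY
      · have hu1 : u.base ∈ Z₁.1 := by
          by_contra hu1
          exact (hs.leIn_right hu1 hux).2 (hY hx.1)
        rw [retract_left hu1, retract_left (hY hx.1)] at hux1
        rw [retract_left hu1, retract_left (hY hy.1)] at huy1
        obtain ⟨v, hv, huv⟩ := ih Z₁ hs.lt_left hY u hux1 huy1
        exact ⟨v, hv, huv.mono hs.lt_left.le⟩
      by_cases hu1 : u.base ∈ Z₁.1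
      -- the copy of `u` in `Z₂` is a common lower bound there
      · rw [retract_left hu1, hs.retract_right (hY hx.1)] at hux1
        rw [retract_left hu1, hs.retract_right (hY hy.1)] at huy1
        have hux2 := h.leIn_transferPoint hs.rank_eq hux1
        have huy2 := h.leIn_transferPoint hs.rank_eq huy1
        rw [h.transferPoint_transferPoint hs.rank_eq.symm (hY hx.1)] at hux2
        rw [h.transferPoint_transferPoint hs.rank_eq.symm (hY hy.1)] at huy2
        obtain ⟨v, hv, huv⟩ := ih Z₂ hs.lt_right hY _ hux2 huy2
        refine ⟨v, hv, ?_⟩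
        have huv1 := h.leIn_transferPoint hs.rank_eq.symm huv
        have hv2 := (hF v hv).mono hY
        rw [h.transferPoint_transferPoint hs.rank_eq hu1, ← hs.retract_right hv2.1] at huv1
        exact (huv1.mono hs.lt_left.le).trans (hs.retract_leIn h hv2)
      · obtain ⟨v, hv, huv⟩ := ih Z₂ hs.lt_right hY u (hs.leIn_right hu1 hux).1
          (hs.leIn_right hu1 huy).1
        exact ⟨v, hv, huv.mono hs.lt_right.le⟩

/-- In a directed set, an old point is present in a smaller set. -/
lemma exists_present_of_directed (h : IsTwoCardinal κ μ) {Y Z : μ} (hY : Y < Z)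
    (hd : ∀ X < Z, ∀ Y < Z, ∃ W < Z, X ≤ W ∧ Y ≤ W) {p : Point κ} (hp : Old Z p) :
    ∃ W < Z, Present W p := by
  have hne : rank μ Z ≠ 0 := ((zero_le).trans_lt (rank_lt hY)).ne'
  have hmem := hp.1
  rw [h.neat Z hne] at hmem
  obtain ⟨X, ⟨hXμ, hXZ⟩, hpX⟩ := hmem
  have hX : (⟨X, hXμ⟩ : μ) < Z := hXZ
  obtain ⟨V, hV, hVr⟩ : ∃ V < Z, age p.name ≤ rank μ V + 1 := by
    have ha := hp.2
    generalize p.name = n at ha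
    rcases n with _ | ⟨⟨ξ, γ⟩, s⟩
    · exact ⟨Y, hY, zero_le⟩
    · obtain ⟨V, hV, hξ⟩ := exists_le_rank ((lt_add_one ξ.toOrd.1).trans_le ha)
      exact ⟨V, hV, add_le_add_left hξ 1⟩
  obtain ⟨W, hW, hXW, hVW⟩ := hd _ hX V hV
  exact ⟨W, hW, hXW hpX, hVr.trans (add_le_add_left (rank_mono hVW) 1)⟩

/-- Two points of `Z` have a finite set of generators of their common lower bounds. -/
lemma exists_coversMeet (h : IsTwoCardinal κ μ) (Z : μ) {x y : Point κ} (hx : Present Z x)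
    (hy : Present Z y) :
    ∃ F : Set (Point κ), F.Finite ∧ (∀ v ∈ F, LeIn Z v x ∧ LeIn Z v y) ∧ CoversMeet Z F x y := by
  induction Z using WellFoundedLT.induction generalizing x y with
  | ind Z ih =>
    by_cases hxo : Old Z x
    swap
    · refine ⟨{u | u = x ∧ LeIn Z u y}, (Set.finite_singleton x).subset fun u hu => hu.1, ?_, ?_⟩
      · rintro v ⟨rfl, hv⟩
        exact ⟨.refl, hv⟩
      · intro u hux huy
        exact ⟨u, ⟨hux.eq_of_not_old hxo, huy⟩, .refl⟩
    by_cases hyo : Old Z y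
    swap
    · refine ⟨{u | u = y ∧ LeIn Z u x}, (Set.finite_singleton y).subset fun u hu => hu.1, ?_, ?_⟩
      · rintro v ⟨rfl, hv⟩
        exact ⟨hv, .refl⟩
      · intro u hux huy
        exact ⟨u, ⟨huy.eq_of_not_old hyo, hux⟩, .refl⟩
    have lift : ∀ Y < Z, Present Y x → Present Y y → ∃ F : Set (Point κ), F.Finite ∧
        (∀ v ∈ F, LeIn Z v x ∧ LeIn Z v y) ∧ CoversMeet Z F x y := by
      intro Y hY hxY hyY
      obtain ⟨F, hF, hFl, hc⟩ := ih Y hY hxY hyY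
      exact ⟨F, hF, fun v hv => ⟨(hFl v hv).1.mono hY.le, (hFl v hv).2.mono hY.le⟩,
        h.coversMeet_mono hY.le hxY hyY (fun v hv => (hFl v hv).1.present hxY) hc⟩
    rcases h.directed_or_isSplit Z with hd | ⟨Z₁, Z₂, hs⟩
    · by_cases hne : ∃ Y, Y < Z
      · obtain ⟨Y, hY⟩ := hne
        obtain ⟨V, hV, hxV⟩ := h.exists_present_of_directed hY hd hxo
        obtain ⟨W, hW, hyW⟩ := h.exists_present_of_directed hY hd hyo
        obtain ⟨X, hX, hVX, hWX⟩ := hd V hV W hW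
        exact lift X hX (hxV.mono hVX) (hyW.mono hWX)
      -- in a minimal set, distinct old points are incomparable
      · have hmin : ∀ u v : Point κ, OldLe Z u v → u = v := by
          intro u v huv
          rcases huv.cases_head with rfl | ⟨c, (⟨Y, hY, -⟩ | ⟨Y, hY, -⟩), -⟩
          · rfl
          · exact absurd ⟨Y, hY⟩ hne
          · exact absurd ⟨Y, hY⟩ hne
        refine ⟨{u | u = x ∧ u = y}, (Set.finite_singleton x).subset fun u hu => hu.1, ?_,
          coversMeet_of_old hxo hyo fun u _ hux huy => ⟨u, ⟨hmin u x hux, hmin u y huy⟩, .refl⟩⟩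
        rintro v ⟨rfl, rfl⟩
        exact ⟨.refl, .refl⟩
    · have hpres1 : ∀ p, Old Z p → p.base ∈ Z₁.1 → Present Z₁ p := fun p hp hp1 =>
        ⟨hp1, hs.rank_top ▸ hp.2⟩
      have hpres2 : ∀ p, Old Z p → p.base ∈ Z₂.1 → Present Z₂ p := fun p hp hp2 =>
        ⟨hp2, by rw [← hs.rank_eq]; exact hs.rank_top ▸ hp.2⟩
      -- if `x` lies in `Z₁` and `y` in `Z₂`, then `y` may be replaced by its copy in `Z₁`
      have key : ∀ x y, Old Z x → Old Z y → x.base ∈ Z₁.1 → y.base ∈ Z₂.1 →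
          ∃ F : Set (Point κ), F.Finite ∧
            (∀ v ∈ F, LeIn Z v x ∧ LeIn Z v y) ∧ CoversMeet Z F x y := by
        intro x y hxo hyo hx1 hy2
        have hy' := hpres2 y hyo hy2
        have hry : Present Z₁ (retract Z₁.1 Z₂.1 y) := by
          rw [hs.retract_right hy2]
          exact h.transferPoint_present hs.rank_eq.symm hy'
        obtain ⟨F, hF, hFl, hc⟩ := ih Z₁ hs.lt_left (hpres1 x hxo hx1) hry
        refine ⟨F, hF, fun v hv => ⟨(hFl v hv).1.mono hs.lt_left.le,
          ((hFl v hv).2.mono hs.lt_left.le).trans (hs.retract_leIn h hy')⟩,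
          coversMeet_of_old hxo hyo fun u _ hux huy => ?_⟩
        have hu1 : u.base ∈ Z₁.1 := by
          by_contra hu1
          exact (hs.leIn_right hu1 hux).2 hx1
        have hux1 := hs.leIn_retract h hux
        have huy1 := hs.leIn_retract h huy
        rw [retract_left hu1] at hux1 huy1
        rw [retract_left hx1] at hux1
        obtain ⟨v, hv, huv⟩ := hc u hux1 huy1
        exact ⟨v, hv, huv.mono hs.lt_left.le⟩
      rcases hs.mem_or_mem _ hxo.1 with hx1 | hx2 <;> rcases hs.mem_or_mem _ hyo.1 with hy1 | hy2
      · exact lift Z₁ hs.lt_left (hpres1 x hxo hx1) (hpres1 y hyo hy1)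
      · exact key x y hxo hyo hx1 hy2
      · obtain ⟨F, hF, hFl, hc⟩ := key y x hyo hxo hy1 hx2
        exact ⟨F, hF, fun v hv => (hFl v hv).symm, fun u hux huy => hc u huy hux⟩
      · exact lift Z₂ hs.lt_right (hpres2 x hxo hx2) (hpres2 y hyo hy2)

/-! ### The scattered order of a two-cardinal -/

lemma exists_old (h : IsTwoCardinal κ μ) (hκ : κ.IsRegular) (p : Point κ) :
    ∃ Z : μ, Old Z p := by
  have hlim : IsSuccLimit κ.ord := isSuccLimit_ord hκ.aleph0_le
  have ha : age p.name < κ.ord := by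
    rcases p.name with _ | ⟨⟨ξ, γ⟩, s⟩
    · exact hlim.bot_lt
    · exact hlim.succ_lt ξ.toOrd.2
  obtain ⟨X, hX⟩ := h.exists_mem p.base
  obtain ⟨Y, hY⟩ := h.exists_rank_ge hκ ha
  obtain ⟨Z, hXZ, hYZ⟩ := h.exists_ge_ge X Y
  exact ⟨Z, hXZ hX, hY.trans (rank_mono hYZ)⟩

lemma exists_old_of_finite (h : IsTwoCardinal κ μ) (hκ : κ.IsRegular) {F : Set (Point κ)}
    (hF : F.Finite) (X : μ) : ∃ Z : μ, X ≤ Z ∧ ∀ p ∈ F, Old Z p := by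
  induction F, hF using Set.Finite.induction_on with
  | empty => exact ⟨X, le_rfl, by simp⟩
  | @insert a s _ _ ih =>
    obtain ⟨Y, hXY, hY⟩ := ih
    obtain ⟨W, hW⟩ := h.exists_old hκ a
    obtain ⟨Z, hYZ, hWZ⟩ := h.exists_ge_ge Y W
    refine ⟨Z, hXY.trans hYZ, ?_⟩
    rintro p (rfl | hp)
    · exact hW.mono hWZ
    · exact (hY p hp).mono hYZ

/-- The order of all points: the union of the orders of the points of the members of `μ`. -/
@[reducible] def pointOrder (h : IsTwoCardinal κ μ) (hκ : κ.IsRegular) :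
    PartialOrder (Point κ) where
  le p q := ∃ Z : μ, LeIn Z p q
  le_refl p := (h.exists_old hκ p).imp fun _ _ => .refl
  le_trans := by
    rintro p q r ⟨Y, hY⟩ ⟨W, hW⟩
    obtain ⟨Z, hYZ, hWZ⟩ := h.exists_ge_ge Y W
    exact ⟨Z, (hY.mono hYZ).trans (hW.mono hWZ)⟩
  le_antisymm := by
    rintro p q ⟨Y, hY⟩ ⟨W, hW⟩
    rcases hY.eq_or_base_lt with hpq | hpq
    · exact hpq
    rcases hW.eq_or_base_lt with hqp | hqp
    · exact hqp.symm
    · exact absurd hpq hqp.not_gt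

theorem isScatteredOrder (h : IsTwoCardinal κ μ) (hκ : κ.IsRegular) :
    letI := h.pointOrder hκ
    IsScatteredOrder (Point κ) Point.level (succ κ).ord := by
  let := h.pointOrder hκ
  have hlev : ∀ p q : Point κ, p.base < q.base → p.level < q.level := fun p q hpq =>
    Ordinal.ToType.mk.symm.strictMono hpq
  refine ⟨fun p q hpq => ?_, fun p => p.base.toOrd.2, ?_, fun α hα => ?_, fun x y => ?_,
    fun x α hα F hF hxF => ?_⟩
  · obtain ⟨Z, hZ⟩ := hpq.le
    exact hlev p q (hZ.eq_or_base_lt.resolve_left hpq.ne)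
  · exact isSuccLimit_ord (hκ.aleph0_le.trans (le_succ κ))
  · refine ⟨⟨Ordinal.ToType.mk ⟨α, hα⟩, []⟩, ?_⟩
    rw [Point.level, Ordinal.ToType.toOrd, OrderIso.symm_apply_apply]
  · obtain ⟨X, hX⟩ := h.exists_old hκ x
    obtain ⟨Z, hXZ, hZ⟩ := h.exists_old_of_finite hκ (Set.finite_singleton y) X
    have hx := (hX.mono hXZ).present
    have hy := (hZ y rfl).present
    obtain ⟨F, hF, hFl, hc⟩ := h.exists_coversMeet Z hx hy
    refine ⟨F, hF, fun u => ⟨?_, ?_⟩⟩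
    · rintro ⟨⟨V, hV⟩, ⟨W, hW⟩⟩
      obtain ⟨Y, hVY, hWY⟩ := h.exists_ge_ge V W
      obtain ⟨S, hYS, hZS⟩ := h.exists_ge_ge Y Z
      obtain ⟨v, hv, huv⟩ := h.coversMeet_mono hZS hx hy
        (fun v hv => (hFl v hv).1.present hx) hc u (hV.mono (hVY.trans hYS))
        (hW.mono (hWY.trans hYS))
      exact ⟨v, hv, S, huv⟩
    · rintro ⟨v, hv, huv⟩
      exact ⟨huv.trans ⟨Z, (hFl v hv).1⟩, huv.trans ⟨Z, (hFl v hv).2⟩⟩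
  · let a : SuccCard κ := Ordinal.ToType.mk ⟨α, hα.trans x.base.toOrd.2⟩
    have ha : a.toOrd.1 = α := by
      rw [Ordinal.ToType.toOrd, OrderIso.symm_apply_apply]
    have hax : a < x.base := by
      rw [← Ordinal.ToType.mk.symm.lt_iff_lt]
      change a.toOrd.1 < x.level
      rwa [ha]
    obtain ⟨X, hX⟩ := h.exists_old hκ x
    obtain ⟨Z, hXZ, hZ⟩ := h.exists_old_of_finite hκ (hF.insert ⟨a, []⟩) X
    have hxZ := hX.mono hXZ
    -- the new point of level `α` added below `x` in a set in which all given points are old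
    let z : Point κ := ⟨a, (Ordinal.ToType.mk ⟨rank μ Z, h.rank_lt_ord Z⟩,
      Ordinal.ToType.mk ⟨pos Z.1 x.base, pos_lt_ord (h.card_lt Z.1 Z.2) _⟩) :: x.name⟩
    have hz : IsChild Z z x := by
      refine ⟨(hZ _ (Set.mem_insert _ _)).1, hxZ.1, hax, hxZ.2, _, _, rfl, ?_, ?_⟩
      · rw [Ordinal.ToType.toOrd, OrderIso.symm_apply_apply]
      · rw [Ordinal.ToType.toOrd, OrderIso.symm_apply_apply]
    refine ⟨z, ha, ⟨Z, .single hz.edge⟩, fun w hw hzw => hxF w hw ?_⟩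
    obtain ⟨W, hW⟩ := hzw
    obtain ⟨V, hZV, hWV⟩ := h.exists_ge_ge Z W
    have hwZ := hZ w (Or.inr hw)
    have hle := h.leIn_restrict hZV hz.edge.present_left hwZ.present (hW.mono hWV)
    rcases hle.eq_or_exists_isChild hz.not_old with rfl | ⟨c, hc, hcw⟩
    · exact absurd hwZ hz.not_old
    · rw [hz.unique hc]
      exact ⟨Z, hcw⟩

end IsTwoCardinal

namespace TwoCardinal

lemma mk_level {κ : Cardinal.{u}} (hκ : ℵ₀ ≤ κ) {α : Ordinal.{u}} (hα : α < (succ κ).ord) :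
    #{p : Point κ | p.level = α} = κ := by
  have hK : #(κ.ord.ToType × κ.ord.ToType) = κ := by
    rw [← mul_def, mk_ord_toType, mul_eq_self hκ]
  have : Infinite (κ.ord.ToType × κ.ord.ToType) := by rwa [infinite_iff, hK]
  refine Eq.trans (mk_congr (Equiv.ofBijective (fun p => p.1.name) ⟨?_, fun s => ?_⟩))
    ((mk_list_eq_mk _).trans hK)
  · rintro ⟨⟨a, s⟩, ha⟩ ⟨⟨b, t⟩, hb⟩ hst
    have hab : a = b := Ordinal.ToType.mk.symm.injective
      (Subtype.ext ((show a.toOrd.1 = α from ha).trans (show b.toOrd.1 = α from hb).symm))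
    obtain rfl : s = t := hst
    subst hab
    rfl
  · refine ⟨⟨⟨Ordinal.ToType.mk ⟨α, hα⟩, s⟩, ?_⟩, rfl⟩
    change (Ordinal.ToType.toOrd (Ordinal.ToType.mk ⟨α, hα⟩)).1 = α
    rw [Ordinal.ToType.toOrd, OrderIso.symm_apply_apply]

end TwoCardinal

theorem mainTheorem9 (κ : Cardinal.{u}) (hκ : κ.IsRegular)
    (hμ : ∃ μ : Set (Set (SuccCard κ)), IsTwoCardinal κ μ) :
    ∃ (B : Type u) (_ : BooleanAlgebra B), IsThinTall κ B := by
  obtain ⟨μ, h⟩ := hμ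
  have := h.wellFounded
  let := h.pointOrder hκ
  exact ⟨_, _, (h.isScatteredOrder hκ).isThinTall hκ.aleph0_le fun α hα =>
    mk_level hκ.aleph0_le hα⟩
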